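/- **Setting.** Let $\mathbb D^2=\{\eta\in\mathbb R^2: |\eta|<1\}$ be the Klein model of the hyperbolic plane $\mathbb H^2$ (complete geodesics are open chords), with the standard orientation, and let $\mathbb S^1=\partial\mathbb D^2\subset\mathbb C$. On $\mathbb R^{1,2}=\mathbb R^3$ let $\langle x,y\rangle=-x_0y_0+x_1y_1+x_2y_2$, and let $x\boxtimes y$ be the vector with $\langle x\boxtimes y,v\rangle=\det(x,y,v)$ for all $v$. Let $\mathfrak{isom}(\mathbb H^2)$ be the Lie algebra of linear maps of $\mathbb R^{1,2}$ that are skew-symmetric for $\langle\cdot,\cdot\rangle$. Each $\mathfrak a$ in it defines the Killing field $\eta\mapsto\frac{d}{dt}\big|_{t=0}e^{t\mathfrak a}\cdot\eta$ on $\mathbb D^2$, where $e^{t\mathfrak a}\cdot\eta$ is the radial projection of $e^{t\mathfrak a}(1,\eta)$. For a spacelike vector $\sigma$ (that is, $\langle\sigma,\sigma\rangle>0$) the Killing field of $\Lambda(\sigma)\colon y\mapsto y\boxtimes\sigma$ is called hyperbolic, with axis $\{\eta\in\mathbb D^2:\langle(1,\eta),\sigma\rangle=0\}$. A *geodesic lamination*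 $\lambda$ is a (possibly empty) set of pairwise disjoint complete geodesics that is closed in the space of unoriented geodesics. Its *strata* are its leaves (the geodesics in $\lambda$) and its gaps (the connected components of the complement of the union of the leaves). A *left* (resp. *right*) *infinitesimal earthquake* is a vector field $\mathcal E$ on $\mathbb D^2$, not necessarily continuous, for which there is a geodesic lamination $\lambda$ such that the restriction of $\mathcal E$ to every stratum $S$ is the restriction of a Killing field $K_S$ and, for any two strata $S,S'$, the comparison field $\mathfrak a=K_{S'}-K_S$ has the following properties: * $\mathfrak a\neq0$, unless possibly when $S$ and $S'$ are both contained in the closure of one and the same stratum (for instance when one of $S,S'$ is contained in the closure of the other); * if $\mathfrak a\ne0$, then $\mathfrak a$ is a hyperbolic Killing field whose axis $\ell$ weakly separates $S$ and $S'$ (they lie in opposite closed half-planes bounded by $\ell$); * if $\mathfrak a\ne0$, then $\mathfrak a$ translates to the left (resp. right) seen from $S$ to $S'$: if a geodesic arc from a point of $S$ to a point of $S'$ meets $\ell$ in exactly one point $x_0$, $v$ is its velocity there, and, for $t>0$, $w$ is the tangent vector of $\ell$ at $x_0$ pointing towards $e^{t\mathfrak a}\cdot x_0$, then $(v,w)$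 is a positive (resp. negative) basis. A vector field $X$ on $\mathbb S^1$ (no regularity assumed) is written $X(z)=iz\,\phi_X(z)$ with $\phi_X:\mathbb S^1\to\mathbb R$; it is called lower (resp. upper) semicontinuous if $\phi_X$ is. A vector field $\mathcal E$ on $\mathbb D^2$ *extends radially* to $X$ if $\lim_{s\to0^+}\mathcal E((1-s)z+sx)=X(z)$ for all $z\in\mathbb S^1$ and $x\in\mathbb D^2$. **Theorem 1.2.** Let $X$ be a vector field on $\mathbb S^1$. 1. If $X$ is lower semicontinuous, then there exists a left infinitesimal earthquake on $\mathbb H^2$ that extends radially to $X$. 2. If $X$ is upper semicontinuous, then there exists a right infinitesimal earthquake on $\mathbb H^2$ that extends radially to $X$. -/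

import Mathlib

open Set Filter Topology

namespace InfEarthquake

noncomputable section

/-! ### Minkowski space and the Lie algebra of infinitesimal isometries -/

/-- The vector space underlying three-dimensional Minkowski space. -/
abbrev Mink : Type := Fin 3 → ℝ

/-- The Lorentzian form of signature `(-,+,+)`. -/
def form (x y : Mink) : ℝ := -(x 0 * y 0) + x 1 * y 1 + x 2 * y 2

/-- The Minkowski cross product. -/
def mcross (x y : Mink) : Mink :=
  ![-(x 1 * y 2 - x 2 * y 1), x 2 * y 0 - x 0 * y 2, x 0 * y 1 - x 1 * y 0]

/-- `mcross x y` is the vector representing `det (x, y, ·)` with respect to the Lorentzian form. -/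
theorem form_mcross (x y v : Mink) : form (mcross x y) v =
    Matrix.det (Matrix.of ![x, y, v]) := by
  simp [form, mcross, Matrix.det_fin_three]
  ring

/-- The Lie algebra of the isometry group of the hyperbolic plane: the operators that are
skew-symmetric with respect to the Lorentzian form. -/
def isomH2 : Submodule ℝ (Mink →L[ℝ] Mink) where
  carrier := {A | ∀ x y, form (A x) y + form x (A y) = 0}
  zero_mem' := by intro x y; simp [form]
  add_mem' := by
    intro A B hA hB x y
    have h1 := hA x y
    have h2 := hB x y
    simp only [form, add_apply, Pi.add_apply] at *
    linarith
  smul_mem' := by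
    intro c A hA x y
    have h1 := hA x y
    have h2 : c * (form (A x) y + form x (A y)) = 0 := by rw [h1, mul_zero]
    simp only [form, smul_apply, Pi.smul_apply, smul_eq_mul] at *
    linarith

/-- The operator `y ↦ y ⊠ σ`. -/
def lamOp (σ : Mink) : Mink →L[ℝ] Mink :=
  LinearMap.toContinuousLinearMap
    { toFun := fun y => mcross y σ
      map_add' := by
        intro x y; ext i; fin_cases i <;> simp [mcross] <;> ring
      map_smul' := by
        intro c x; ext i; fin_cases i <;> simp [mcross] <;> ring }

theorem lamOp_apply (σ y : Mink) : lamOp σ y = mcross y σ := rfl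

/-- The element `Λ(σ)` of the Lie algebra, `Λ(σ)(y) = y ⊠ σ`. -/
def Lam (σ : Mink) : isomH2 :=
  ⟨lamOp σ, by
    intro x y
    simp only [lamOp_apply, form, mcross]
    simp
    ring⟩

/-! ### The Klein model -/

/-- The Klein model of the hyperbolic plane: the open unit disc. -/
def Disc : Set ℂ := Metric.ball 0 1

/-- The point `(1, η)` of Minkowski space. -/
def lift (η : ℂ) : Mink := ![1, η.re, η.im]

/-- The radial projection `(x₀, x₁, x₂) ↦ (x₁ / x₀, x₂ / x₀)`, which identifies the hyperboloid with
the disc. -/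
def proj (y : Mink) : ℂ := ⟨y 1 / y 0, y 2 / y 0⟩

/-- The one-parameter group `exp (t A)` acting on the Klein model. -/
def flow (A : isomH2) (t : ℝ) (η : ℂ) : ℂ :=
  proj (NormedSpace.exp (t • (A : Mink →L[ℝ] Mink)) (lift η))

/-- The Killing vector field of the hyperbolic plane defined by `A`, in the Klein model: the velocity
at time zero of the one-parameter group of isometries generated by `A`. -/
def killing (A : isomH2) (η : ℂ) : ℂ := deriv (fun t : ℝ => flow A t η) 0

theorem hasDerivAt_flow (A : isomH2) (η : ℂ) :
    HasDerivAt (fun t : ℝ => flow A t η)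
      (⟨(A : Mink →L[ℝ] Mink) (lift η) 1 - η.re * (A : Mink →L[ℝ] Mink) (lift η) 0,
        (A : Mink →L[ℝ] Mink) (lift η) 2 - η.im * (A : Mink →L[ℝ] Mink) (lift η) 0⟩ : ℂ) 0 := by
  have h1 : HasDerivAt (fun t : ℝ => NormedSpace.exp (t • (A : Mink →L[ℝ] Mink)) (lift η))
      ((A : Mink →L[ℝ] Mink) (lift η)) 0 := by
    have h := hasDerivAt_exp_smul_const (𝕂 := ℝ) (A : Mink →L[ℝ] Mink) (0 : ℝ)
    have h' := h.clm_apply (hasDerivAt_const (0 : ℝ) (lift η))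
    simpa using h'
  have hc := hasDerivAt_pi.1 h1
  have h0 : (NormedSpace.exp ((0 : ℝ) • (A : Mink →L[ℝ] Mink)) (lift η)) 0 = 1 := by
    simp [lift]
  have hd1 := (hc 1).div (hc 0) (by rw [h0]; exact one_ne_zero)
  have hd2 := (hc 2).div (hc 0) (by rw [h0]; exact one_ne_zero)
  have h3 := hd1.ofReal_comp.add (hd2.ofReal_comp.mul_const Complex.I)
  refine (h3.congr_deriv ?_).congr_of_eventuallyEq (Eventually.of_forall fun t => ?_)
  · apply Complex.ext <;> simp [lift]
  · apply Complex.ext <;> simp [flow, proj]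

/-! ### Vector fields on the circle -/

/-- `X` is a vector field on the unit circle (no regularity is required). -/
def IsVectorField (X : Circle → ℂ) : Prop := ∀ z : Circle, inner ℝ (z : ℂ) (X z) = 0

/-- The support function of a vector field on the circle: `X z = φ(z) i z`. -/
def supportFunction (X : Circle → ℂ) (z : Circle) : ℝ := inner ℝ (Complex.I * (z : ℂ)) (X z)

theorem eq_supportFunction_mul {X : Circle → ℂ} (hX : IsVectorField X) (z : Circle) :
    X z = (supportFunction X z : ℂ) * (Complex.I * (z : ℂ)) := by
  have h := hX z
  have hz : (z : ℂ).re * (z : ℂ).re + (z : ℂ).im * (z : ℂ).im = 1 := by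
    have := Circle.normSq_coe z
    rwa [Complex.normSq_apply] at this
  simp only [Complex.inner, Complex.mul_re, Complex.conj_re, Complex.conj_im] at h
  apply Complex.ext
  · simp [supportFunction, Complex.inner]
    linear_combination (-(X z).re) * hz + (z : ℂ).re * h
  · simp [supportFunction, Complex.inner]
    linear_combination (-(X z).im) * hz + (z : ℂ).im * h

/-- The vector field `E` on the disc extends radially to the vector field `X` on the circle. -/
def ExtendsRadially (E : ℂ → ℂ) (X : Circle → ℂ) : Prop :=
  ∀ z : Circle, ∀ x ∈ Disc,
    Tendsto (fun s : ℝ => E ((1 - s) • (z : ℂ) + s • x)) (𝓝[>] 0) (𝓝 (X z))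

/-! ### Geodesic laminations -/

/-- The complete geodesic of the Klein model with ideal endpoints `p.1` and `p.2`. -/
def geod (p : Circle × Circle) : Set ℂ := openSegment ℝ (p.1 : ℂ) (p.2 : ℂ)

/-- A geodesic lamination: a closed set of pairwise disjoint complete geodesics. An unoriented geodesic
is an unordered pair of distinct points of the circle, so a closed set of geodesics is a symmetric set
of ordered pairs that is relatively closed in the complement of the diagonal. -/
structure GeodesicLamination where
  leaves : Set (Circle × Circle)
  ne_of_mem : ∀ p ∈ leaves, p.1 ≠ p.2
  symm : ∀ p ∈ leaves, p.swap ∈ leaves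
  closed : IsClosed {p : {q : Circle × Circle // q.1 ≠ q.2} | (p : Circle × Circle) ∈ leaves}
  disjoint : ∀ p ∈ leaves, ∀ q ∈ leaves, q ≠ p → q ≠ p.swap → Disjoint (geod p) (geod q)

/-- The union of the leaves. -/
def GeodesicLamination.union (L : GeodesicLamination) : Set ℂ := ⋃ p ∈ L.leaves, geod p

/-- The strata of a geodesic lamination are its leaves and its gaps, i.e. the connected components of
the complement of the union of the leaves. -/
def GeodesicLamination.IsStratum (L : GeodesicLamination) (S : Set ℂ) : Prop :=
  (∃ p ∈ L.leaves, S = geod p) ∨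
    ∃ x ∈ Disc \ L.union, S = connectedComponentIn (Disc \ L.union) x

/-! ### Infinitesimal earthquakes -/

/-- The axis of the hyperbolic Killing field `Λ(σ)`, where `σ` is spacelike. -/
def axis (σ : Mink) : Set ℂ := {η | η ∈ Disc ∧ form (lift η) σ = 0}

/-- The geodesic orthogonal to `σ` weakly separates `S` and `S'`: they lie in opposite closed
half-planes. -/
def WeaklySeparates (σ : Mink) (S S' : Set ℂ) : Prop :=
  ((∀ p ∈ S, form (lift p) σ ≤ 0) ∧ ∀ q ∈ S', 0 ≤ form (lift q) σ) ∨
    ((∀ p ∈ S, 0 ≤ form (lift p) σ) ∧ ∀ q ∈ S', form (lift q) σ ≤ 0)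

/-- The determinant of the pair `(v, w)` with respect to the standard orientation of the plane. -/
def orient (v w : ℂ) : ℝ := v.re * w.im - v.im * w.re

/-- The one-parameter group of `a` translates along `ℓ` to the left, seen from `S` to `S'`: if a geodesic
arc from a point of `S` to a point of `S'` meets `ℓ` in exactly one point `x`, then the velocity of the
arc at `x` followed by the vector at `x` tangent to `ℓ` that points towards `exp (t a) x` is a positive
basis (geodesics of the Klein model are straight segments). -/
def TranslatesLeft (a : isomH2) (ℓ S S' : Set ℂ) : Prop :=
  ∀ p ∈ S, ∀ q ∈ S', ∀ x : ℂ, segment ℝ p q ∩ ℓ = {x} →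
    ∀ t : ℝ, 0 < t → 0 < orient (q - p) (flow a t x - x)

/-- The same with a negative basis. -/
def TranslatesRight (a : isomH2) (ℓ S S' : Set ℂ) : Prop :=
  ∀ p ∈ S, ∀ q ∈ S', ∀ x : ℂ, segment ℝ p q ∩ ℓ = {x} →
    ∀ t : ℝ, 0 < t → orient (q - p) (flow a t x - x) < 0

/-- `E` is an infinitesimal earthquake, where `T` is the required direction of translation.
On each stratum `S` it agrees with a Killing field, generated by `K S`; the comparison of `S` and
`S'` is the Killing field generated by `K S' - K S`. It may vanish only when `S` and `S'` both lie in
the closure of one stratum, for example when one lies in the closure of the other. When it does not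
vanish it is a hyperbolic Killing field, whose axis weakly separates `S` and `S'`, and which translates
in the direction `T`, seen from `S` to `S'`. Only the values of `E` on the disc matter. -/
def IsInfEarthquake (T : isomH2 → Set ℂ → Set ℂ → Set ℂ → Prop) (E : ℂ → ℂ) : Prop :=
  ∃ (L : GeodesicLamination) (K : Set ℂ → isomH2),
    (∀ S, L.IsStratum S → ∀ η ∈ S, E η = killing (K S) η) ∧
    ∀ S S', L.IsStratum S → L.IsStratum S' →
      (K S' - K S = 0 → ∃ R, L.IsStratum R ∧ S ⊆ closure R ∧ S' ⊆ closure R) ∧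
      (K S' - K S ≠ 0 → ∃ σ : Mink, 0 < form σ σ ∧ K S' - K S = Lam σ ∧
        WeaklySeparates σ S S' ∧ T (K S' - K S) (axis σ) S S')

/-- Left infinitesimal earthquakes. -/
def IsLeftInfEarthquake (E : ℂ → ℂ) : Prop := IsInfEarthquake TranslatesLeft E

/-- Right infinitesimal earthquakes. -/
def IsRightInfEarthquake (E : ℂ → ℂ) : Prop := IsInfEarthquake TranslatesRight E

end

end InfEarthquake

/-! On the unit circle the Killing field of `Lam σ` is `iz` times the affine function `aff σ`
(`killing_Lam`), so Killing fields correspond to affine functions on the plane. Given a lower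
semicontinuous `φ`, let `u` be the supremum of its affine minorants. It is convex, takes the values
`φ` on the circle (`envelope_coe`) and has a support plane at every point of the disc
(`exists_support`). The earthquake is, at each point, the Killing field of a support plane of `u`
there.

Each face of `u` is the trace on the disc of the convex hull of its contact points with `φ`
(`face_subset_convexHull_contact`). Face interiors are the gaps of a lamination; by Carathéodory
every other point lies on a chord between contact points, and these chords are the leaves. One
support plane serves a whole stratum. For two strata with support planes `σ` and `σ'`, the affine
function of `σ' - σ` is nonpositive on the first and nonnegative on the second. Hence it vanishes in
the disc, which makes the comparison hyperbolic with a separating axis; its translation is along the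
gradient turned by a positive right angle, so it goes to the left.

For the radial limit, `u` tends to `φ z` along segments ending at `z`, and the gradient term of the
Killing field disappears because convexity makes the gradient negligible against the inverse
distance to the circle (`tendsto_mul_norm_gradient_radial`). The right-handed case is the
left-handed one for `-φ`, with signs changed. -/

namespace InfEarthquake

noncomputable section

/-! ### Affine functions and Killing fields -/

/-- The affine function on the plane defined by a vector of Minkowski space. -/
def aff (σ : Mink) (η : ℂ) : ℝ := form (lift η) σ

theorem aff_eq (σ : Mink) (η : ℂ) : aff σ η = -σ 0 + η.re * σ 1 + η.im * σ 2 := by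
  simp [aff, form, lift]

theorem aff_sub (σ τ : Mink) (η : ℂ) : aff (σ - τ) η = aff σ η - aff τ η := by
  simp only [aff_eq, Pi.sub_apply]; ring

theorem aff_neg (σ : Mink) (η : ℂ) : aff (-σ) η = -aff σ η := by
  simp only [aff_eq, Pi.neg_apply]; ring

theorem aff_add (σ τ : Mink) (η : ℂ) : aff (σ + τ) η = aff σ η + aff τ η := by
  simp only [aff_eq, Pi.add_apply]; ring

theorem aff_smul (c : ℝ) (σ : Mink) (η : ℂ) : aff (c • σ) η = c * aff σ η := by
  simp only [aff_eq, Pi.smul_apply, smul_eq_mul]; ring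

theorem aff_combo (σ : Mink) (x y : ℂ) {a b : ℝ} (h : a + b = 1) :
    aff σ (a • x + b • y) = a * aff σ x + b * aff σ y := by
  simp only [aff_eq, Complex.add_re, Complex.add_im, Complex.smul_re, Complex.smul_im, smul_eq_mul]
  linear_combination σ 0 * h

theorem continuous_aff (σ : Mink) : Continuous (aff σ) := by
  have : aff σ = fun η : ℂ => -σ 0 + η.re * σ 1 + η.im * σ 2 := funext (aff_eq σ)
  rw [this]
  fun_prop

theorem concaveOn_aff (σ : Mink) {s : Set ℂ} (hs : Convex ℝ s) : ConcaveOn ℝ s (aff σ) :=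
  ⟨hs, fun x _ y _ _ _ _ _ h => (aff_combo σ x y h).ge⟩

theorem mem_Disc {η : ℂ} : η ∈ Disc ↔ ‖η‖ < 1 := by simp [Disc]

theorem isOpen_Disc : IsOpen Disc := Metric.isOpen_ball

theorem convex_Disc : Convex ℝ Disc := convex_ball _ _

theorem sq_add_sq_lt_one {η : ℂ} (h : η ∈ Disc) : η.re ^ 2 + η.im ^ 2 < 1 := by
  have h1 := mem_Disc.1 h
  have h2 := Complex.sq_norm η
  rw [Complex.normSq_apply] at h2
  nlinarith [norm_nonneg η]

/-- A nonconstant affine function decreases strictly against its gradient, so it has no local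
minimum. -/
theorem eq_zero_of_aff_eq_zero_of_nonneg {σ : Mink} {x : ℂ} (h0 : aff σ x = 0)
    (h : ∀ᶠ y in 𝓝 x, 0 ≤ aff σ y) : σ = 0 := by
  have key : ∀ v : ℂ, aff σ (x + v) = v.re * σ 1 + v.im * σ 2 := by
    intro v
    rw [aff_eq] at h0
    rw [aff_eq, Complex.add_re, Complex.add_im]
    linear_combination h0
  have ht : Tendsto (fun s : ℝ => x + (s : ℂ) * (-(⟨σ 1, σ 2⟩ : ℂ))) (𝓝 0) (𝓝 x) := by
    have : Continuous (fun s : ℝ => x + (s : ℂ) * (-(⟨σ 1, σ 2⟩ : ℂ))) := by fun_prop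
    simpa using this.tendsto 0
  have h1 : ∀ᶠ s : ℝ in 𝓝[>] 0, 0 ≤ aff σ (x + (s : ℂ) * (-(⟨σ 1, σ 2⟩ : ℂ))) :=
    (ht.mono_left nhdsWithin_le_nhds).eventually h
  obtain ⟨s, hs, hs0⟩ := (h1.and self_mem_nhdsWithin).exists
  rw [key] at hs
  have hs0 : 0 < s := hs0
  simp at hs
  have h12 : σ 1 ^ 2 + σ 2 ^ 2 ≤ 0 := by
    by_contra hc
    push Not at hc
    nlinarith [mul_pos hs0 hc]
  have e1 : σ 1 = 0 := by nlinarith [sq_nonneg (σ 1), sq_nonneg (σ 2)]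
  have e2 : σ 2 = 0 := by nlinarith [sq_nonneg (σ 1), sq_nonneg (σ 2)]
  rw [aff_eq, e1, e2] at h0
  ext i
  fin_cases i
  · simpa using h0
  · exact e1
  · exact e2

/-- A zero `x` gives `σ 0 = x · g` with `g = (σ 1, σ 2)`; Cauchy–Schwarz and `‖x‖ < 1` then give `(σ
0)² < ‖g‖²`. -/
theorem form_self_pos {σ : Mink} (hσ : σ ≠ 0) {x : ℂ} (hx : x ∈ Disc) (h0 : aff σ x = 0) :
    0 < form σ σ := by
  have hx' := sq_add_sq_lt_one hx
  rw [aff_eq] at h0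
  have h1 : σ 0 = x.re * σ 1 + x.im * σ 2 := by linarith
  have hpos : 0 < σ 1 ^ 2 + σ 2 ^ 2 := by
    by_contra hc
    have e1 : σ 1 = 0 := by nlinarith [sq_nonneg (σ 1), sq_nonneg (σ 2)]
    have e2 : σ 2 = 0 := by nlinarith [sq_nonneg (σ 1), sq_nonneg (σ 2)]
    apply hσ
    ext i
    fin_cases i
    · simpa [e1, e2] using h1
    · exact e1
    · exact e2
  simp only [form, h1]
  nlinarith [sq_nonneg (x.re * σ 2 - x.im * σ 1), mul_pos hpos (sub_pos.2 hx')]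

theorem Lam_sub (σ τ : Mink) : Lam σ - Lam τ = Lam (σ - τ) := by
  apply Subtype.ext
  ext y i
  fin_cases i <;> simp [Lam, lamOp_apply, mcross] <;> ring

theorem Lam_neg (σ : Mink) : Lam (-σ) = -Lam σ := by
  apply Subtype.ext
  ext y i
  fin_cases i <;> simp [Lam, lamOp_apply, mcross] <;> ring

theorem Lam_injective : Function.Injective Lam := by
  intro σ τ h
  have h1 : lamOp σ = lamOp τ := congrArg Subtype.val h
  have h2 : mcross ![1, 0, 0] σ = mcross ![1, 0, 0] τ := by
    rw [← lamOp_apply, ← lamOp_apply, h1]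
  have h3 : mcross ![0, 1, 0] σ = mcross ![0, 1, 0] τ := by
    rw [← lamOp_apply, ← lamOp_apply, h1]
  have a1 := congrFun h2 1
  have a2 := congrFun h2 2
  have a3 := congrFun h3 2
  simp [mcross] at a1 a2 a3
  ext i
  fin_cases i
  · exact a3
  · exact a2
  · exact a1

/-- The second term vanishes on the circle; inside the disc it is the gradient term to be controlled
in the radial limit. -/
theorem killing_Lam (σ : Mink) (η : ℂ) :
    killing (Lam σ) η = Complex.I * η * (aff σ η : ℂ) +
      Complex.I * ((1 - ‖η‖ ^ 2 : ℝ) : ℂ) * (⟨σ 1, σ 2⟩ : ℂ) := by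
  have h2 := Complex.sq_norm η
  rw [Complex.normSq_apply] at h2
  rw [killing, (hasDerivAt_flow (Lam σ) η).deriv, aff_eq, h2]
  apply Complex.ext
  · simp [Lam, lamOp_apply, mcross, lift]; ring
  · simp [Lam, lamOp_apply, mcross, lift]; ring

theorem killing_neg (A : isomH2) (η : ℂ) : killing (-A) η = -killing A η := by
  rw [killing, killing, (hasDerivAt_flow A η).deriv, (hasDerivAt_flow (-A) η).deriv]
  apply Complex.ext <;> simp <;> ring

/-! ### The flow along the axis -/

/-- Applying `exp (-tA)` to the proposed right-hand side gives a curve with zero derivative, hence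
constantly `y`. -/
theorem exp_smul_apply_of_sq_eq (A : Mink →L[ℝ] Mink) (y : Mink) {c : ℝ} (hc : 0 < c)
    (h : A (A y) = c ^ 2 • y) (t : ℝ) :
    NormedSpace.exp (t • A) y = Real.cosh (c * t) • y + (Real.sinh (c * t) / c) • A y := by
  have hd : ∀ t : ℝ, HasDerivAt (fun t : ℝ => NormedSpace.exp ((-t) • A)
      (Real.cosh (c * t) • y + (Real.sinh (c * t) / c) • A y)) 0 t := by
    intro t
    have h1 : HasDerivAt (fun t : ℝ => NormedSpace.exp ((-t) • A))
        (-(NormedSpace.exp ((-t) • A) * A)) t := by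
      have := (hasDerivAt_exp_smul_const (𝕂 := ℝ) A (-t)).scomp t (hasDerivAt_neg t)
      refine this.congr_deriv ?_
      exact (neg_smul (1 : ℝ) _).trans (congrArg _ (one_smul ℝ _))
    have hl : HasDerivAt (fun t : ℝ => c * t) c t := by
      simpa using (hasDerivAt_id t).const_mul c
    have h2 : HasDerivAt (fun t : ℝ => Real.cosh (c * t) • y + (Real.sinh (c * t) / c) • A y)
        ((Real.sinh (c * t) * c) • y + (Real.cosh (c * t) * c / c) • A y) t :=
      (((Real.hasDerivAt_cosh _).comp t hl).smul_const y).add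
        ((((Real.hasDerivAt_sinh _).comp t hl).div_const c).smul_const (A y))
    refine (h1.clm_apply h2).congr_deriv ?_
    have hz : -A (Real.cosh (c * t) • y + (Real.sinh (c * t) / c) • A y) +
        ((Real.sinh (c * t) * c) • y + (Real.cosh (c * t) * c / c) • A y) = 0 := by
      rw [map_add, map_smul, map_smul, h]
      ext i
      simp
      field_simp
      ring
    rw [neg_apply, mul_apply_eq_comp, ← map_neg, ← map_add, hz, map_zero]
  have hconst := is_const_of_deriv_eq_zero (fun t => (hd t).differentiableAt)
    (fun t => (hd t).deriv) t 0
  have hinv : NormedSpace.exp (t • A) * NormedSpace.exp ((-t) • A) = 1 := by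
    rw [show (-t) • A = -(t • A) from neg_smul t A]
    let _ : NormedAlgebra ℚ (Mink →L[ℝ] Mink) := NormedAlgebra.restrictScalars ℚ ℝ _
    exact ((NormedSpace.exp_add_of_commute (Commute.refl (t • A)).neg_right).symm.trans
      (by rw [show t • A + -(t • A) = 0 from add_neg_cancel _])).trans NormedSpace.exp_zero
  have := congrArg (fun v => (NormedSpace.exp (t • A) : Mink →L[ℝ] Mink) v) hconst
  simp only [← mul_apply_eq_comp, hinv] at this
  simpa using this.symm

/-- Along its axis, the flow of `Λ(σ)` moves the points in the direction obtained by rotating the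
gradient of the associated affine function by a positive right angle. -/
theorem exists_flow_sub_eq {σ : Mink} (hσ : 0 < form σ σ) {x : ℂ} (hx : x ∈ Disc)
    (h0 : aff σ x = 0) {t : ℝ} (ht : 0 < t) :
    ∃ c : ℝ, 0 < c ∧ flow (Lam σ) t x - x = c • (Complex.I * (⟨σ 1, σ 2⟩ : ℂ)) := by
  have hx' := sq_add_sq_lt_one hx
  have h0' : σ 0 = x.re * σ 1 + x.im * σ 2 := by rw [aff_eq] at h0; linarith
  set c := Real.sqrt (form σ σ) with hc
  have hcpos : 0 < c := Real.sqrt_pos.2 hσ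
  have hc2 : c ^ 2 = -(σ 0 * σ 0) + σ 1 * σ 1 + σ 2 * σ 2 := by
    rw [hc, Real.sq_sqrt hσ.le]; rfl
  -- On the plane orthogonal to `σ`, the square of `Λ(σ)` is multiplication by `form σ σ`.
  have hsq : lamOp σ (lamOp σ (lift x)) = c ^ 2 • lift x := by
    rw [hc2]
    ext i
    fin_cases i <;> simp [lamOp_apply, mcross, lift, h0'] <;> ring
  have hexp := exp_smul_apply_of_sq_eq (lamOp σ) (lift x) hcpos hsq t
  set C := Real.cosh (c * t)
  set S := Real.sinh (c * t)
  have hS : 0 < S := Real.sinh_pos_iff.2 (by positivity)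
  have hCS : S < C := Real.sinh_lt_cosh _
  -- `m` is the zeroth coordinate of `lamOp σ (lift x)`. The bound `-c ≤ m` and `sinh < cosh` keep
  -- the denominator of the radial projection positive.
  set m := x.im * σ 1 - x.re * σ 2 with hm
  have hmle : -c ≤ m := by
    have : m ^ 2 ≤ c ^ 2 := by
      rw [hc2, hm, h0']
      nlinarith [sq_nonneg (σ 1), sq_nonneg (σ 2)]
    exact (abs_le_of_sq_le_sq' this hcpos.le).1
  have hden : 0 < C + S / c * m := by
    have h1 : S / c * (-c) ≤ S / c * m := by gcongr
    have h2 : S / c * (-c) = -S := by field_simp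
    linarith
  refine ⟨S / c * (1 - (x.re ^ 2 + x.im ^ 2)) / (C + S / c * m), by
    have := sub_pos.2 hx'
    positivity, ?_⟩
  have hfl : flow (Lam σ) t x = proj (C • lift x + (S / c) • lamOp σ (lift x)) := by
    rw [flow, ← hexp]; rfl
  have e0 : (C • lift x + (S / c) • lamOp σ (lift x)) 0 = C + S / c * m := by
    simp [lift, lamOp_apply, mcross, hm]
  have e1 : (C • lift x + (S / c) • lamOp σ (lift x)) 1 = C * x.re + S / c * (x.im * σ 0 - σ 2) := by
    simp [lift, lamOp_apply, mcross]
  have e2 : (C • lift x + (S / c) • lamOp σ (lift x)) 2 = C * x.im + S / c * (σ 1 - x.re * σ 0) := by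
    simp [lift, lamOp_apply, mcross]
  rw [hfl, proj, e0, e1, e2]
  have hne := hden.ne'
  set k := S / c
  apply Complex.ext
  · simp only [Complex.sub_re, Complex.smul_re, Complex.mul_re, Complex.I_re, Complex.I_im,
      smul_eq_mul]
    rw [div_sub' hne, div_mul_eq_mul_div]
    rw [hm, h0']
    ring
  · simp only [Complex.sub_im, Complex.smul_im, Complex.mul_im, Complex.I_re, Complex.I_im,
      smul_eq_mul]
    rw [div_sub' hne, div_mul_eq_mul_div]
    rw [hm, h0']
    ring

/-- The determinant of `v` and `i g` is the scalar product `v · g`, so the side of the translation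
is read off from the growth of the affine function along the arc. -/
theorem exists_orient_flow_eq {σ : Mink} (hσ : 0 < form σ σ) {x : ℂ} (hx : x ∈ axis σ)
    {t : ℝ} (ht : 0 < t) (p q : ℂ) :
    ∃ c : ℝ, 0 < c ∧ orient (q - p) (flow (Lam σ) t x - x) = c * (aff σ q - aff σ p) := by
  obtain ⟨c, hc, h⟩ := exists_flow_sub_eq hσ hx.1 hx.2 ht
  refine ⟨c, hc, ?_⟩
  rw [h]
  simp [orient, aff_eq]
  ring

theorem segment_inter_axis_of_aff_eq_zero {σ : Mink} {p q : ℂ} (hp : p ∈ Disc) (hq : q ∈ Disc)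
    (h1 : aff σ p = 0) (h2 : aff σ q = 0) {x : ℂ} (h : segment ℝ p q ∩ axis σ = {x}) : p = q := by
  have hp' : p ∈ segment ℝ p q ∩ axis σ := ⟨left_mem_segment ℝ p q, hp, h1⟩
  have hq' : q ∈ segment ℝ p q ∩ axis σ := ⟨right_mem_segment ℝ p q, hq, h2⟩
  rw [h] at hp' hq'
  exact hp'.trans hq'.symm

/-- Only strictness needs care: equal values at `p` and `q` would put both on the axis, and an
intersection in one point would make them equal, against disjointness. -/
theorem translatesLeft_Lam {σ : Mink} (hσ : 0 < form σ σ) {S S' : Set ℂ} (hS : S ⊆ Disc)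
    (hS' : S' ⊆ Disc) (hd : Disjoint S S') (h1 : ∀ p ∈ S, aff σ p ≤ 0)
    (h2 : ∀ q ∈ S', 0 ≤ aff σ q) : TranslatesLeft (Lam σ) (axis σ) S S' := by
  intro p hp q hq x hx t ht
  have hxa : x ∈ axis σ := (hx.ge (mem_singleton x)).2
  obtain ⟨c, hc, h⟩ := exists_orient_flow_eq hσ hxa ht p q
  rw [h]
  refine mul_pos hc (lt_of_le_of_ne (by linarith [h1 p hp, h2 q hq]) fun he => ?_)
  have hpq := segment_inter_axis_of_aff_eq_zero (hS hp) (hS' hq)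
    (by linarith [h1 p hp, h2 q hq]) (by linarith [h1 p hp, h2 q hq]) hx
  exact hd.le_bot ⟨hp, hpq ▸ hq⟩

theorem translatesRight_Lam {σ : Mink} (hσ : 0 < form σ σ) {S S' : Set ℂ} (hS : S ⊆ Disc)
    (hS' : S' ⊆ Disc) (hd : Disjoint S S') (h1 : ∀ p ∈ S, 0 ≤ aff σ p)
    (h2 : ∀ q ∈ S', aff σ q ≤ 0) : TranslatesRight (Lam σ) (axis σ) S S' := by
  intro p hp q hq x hx t ht
  have hxa : x ∈ axis σ := (hx.ge (mem_singleton x)).2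
  obtain ⟨c, hc, h⟩ := exists_orient_flow_eq hσ hxa ht p q
  rw [h]
  refine mul_neg_of_pos_of_neg hc (lt_of_le_of_ne (by linarith [h1 p hp, h2 q hq]) fun he => ?_)
  have hpq := segment_inter_axis_of_aff_eq_zero (hS hp) (hS' hq)
    (by linarith [h1 p hp, h2 q hq]) (by linarith [h1 p hp, h2 q hq]) hx
  exact hd.le_bot ⟨hp, hpq ▸ hq⟩

/-! ### Tools from convexity -/

theorem exists_aff_eq_zero {σ : Mink} {p q : ℂ} (hp : p ∈ Disc) (hq : q ∈ Disc)
    (h1 : aff σ p ≤ 0) (h2 : 0 ≤ aff σ q) : ∃ x ∈ Disc, aff σ x = 0 := by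
  obtain ⟨x, hx, h⟩ := convex_Disc.isPreconnected.intermediate_value hp hq
    (continuous_aff σ).continuousOn ⟨h1, h2⟩
  exact ⟨x, hx, h⟩

/-- By Carathéodory at most `dim E + 1` points are needed, so the hull is a finite union of
continuous images of products of a simplex with powers of `C`. -/
theorem isCompact_convexHull_of_isCompact {E : Type*} [NormedAddCommGroup E] [NormedSpace ℝ E]
    [FiniteDimensional ℝ E] {C : Set E} (hC : IsCompact C) : IsCompact (convexHull ℝ C) := by
  have key : convexHull ℝ C = ⋃ k ∈ Finset.range (Module.finrank ℝ E + 2),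
      (fun p : (Fin k → ℝ) × (Fin k → E) => ∑ i, p.1 i • p.2 i) ''
        (stdSimplex ℝ (Fin k) ×ˢ Set.pi univ fun _ => C) := by
    apply Subset.antisymm
    · intro x hx
      obtain ⟨ι, _, z, w, hz, hi, hw, hw1, hx⟩ := eq_pos_convex_span_of_mem_convexHull hx
      let e := Fintype.equivFin ι
      refine mem_iUnion₂.2 ⟨Fintype.card ι, Finset.mem_range.2 ?_,
        (w ∘ e.symm, z ∘ e.symm), ⟨⟨fun i => (hw _).le, ?_⟩, ?_⟩, ?_⟩
      · have h1 := hi.card_le_finrank_succ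
        have h2 := Submodule.finrank_le (vectorSpan ℝ (Set.range z))
        omega
      · exact (e.symm.sum_comp w).trans hw1
      · exact fun i _ => hz (mem_range_self _)
      · exact (e.symm.sum_comp fun i => w i • z i).trans hx
    · refine iUnion₂_subset fun k _ => ?_
      rintro _ ⟨⟨w, z⟩, ⟨⟨hw, hw1⟩, hz⟩, rfl⟩
      exact mem_convexHull_of_exists_fintype w z hw hw1 (fun i => hz i (mem_univ i)) rfl
  rw [key]
  refine Finset.isCompact_biUnion _ fun k _ => ?_
  refine ((isCompact_stdSimplex ℝ (Fin k)).prod (isCompact_univ_pi fun _ => hC)).image ?_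
  fun_prop

theorem exists_forall_aff_eq (g : ℂ →L[ℝ] ℝ) (c : ℝ) : ∃ σ : Mink, ∀ x, aff σ x = g x + c := by
  refine ⟨![-c, g 1, g Complex.I], fun x => ?_⟩
  have h : x = x.re • (1 : ℂ) + x.im • Complex.I := by
    apply Complex.ext <;> simp
  conv_rhs => rw [h, map_add, map_smul, map_smul]
  simp [aff_eq]
  ring

/-! ### The convex envelope of a function on the circle -/

/-- The vectors whose affine function lies below `φ` on the circle. -/
def minorants (φ : Circle → ℝ) : Set Mink := {σ | ∀ z : Circle, aff σ z ≤ φ z}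

/-- The supremum of the affine functions that lie below `φ` on the circle. -/
def envelope (φ : Circle → ℝ) (η : ℂ) : ℝ := sSup ((fun σ => aff σ η) '' minorants φ)

variable {φ : Circle → ℝ}

/-- The two points are the ends of a diameter through `η`. This bounds affine minorants at `η` by
values of `φ`. -/
theorem exists_eq_combo_circle {η : ℂ} (h : ‖η‖ ≤ 1) : ∃ (z w : Circle) (a b : ℝ),
    0 ≤ a ∧ 0 ≤ b ∧ a + b = 1 ∧ η = a • (z : ℂ) + b • (w : ℂ) := by
  obtain ⟨z, hz⟩ : ∃ z : Circle, η = ‖η‖ • (z : ℂ) := by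
    refine ⟨Circle.exp η.arg, ?_⟩
    rw [Circle.coe_exp, Complex.real_smul, Complex.norm_mul_exp_arg_mul_I]
  refine ⟨z, -z, (1 + ‖η‖) / 2, (1 - ‖η‖) / 2, by positivity, by linarith, by ring, ?_⟩
  conv_lhs => rw [hz]
  rw [Circle.coe_neg, smul_neg, ← sub_eq_add_neg, ← sub_smul]
  congr 1
  ring

theorem bddAbove_aff_minorants (φ : Circle → ℝ) {η : ℂ} (h : ‖η‖ ≤ 1) :
    BddAbove ((fun σ => aff σ η) '' minorants φ) := by
  obtain ⟨z, w, a, b, ha, hb, hab, rfl⟩ := exists_eq_combo_circle h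
  refine ⟨a * φ z + b * φ w, ?_⟩
  rintro _ ⟨σ, hσ, rfl⟩
  have h1 := mul_le_mul_of_nonneg_left (hσ z) ha
  have h2 := mul_le_mul_of_nonneg_left (hσ w) hb
  simp only [aff_combo σ _ _ hab]
  linarith

theorem aff_le_envelope {σ : Mink} (hσ : σ ∈ minorants φ) {η : ℂ} (h : ‖η‖ ≤ 1) :
    aff σ η ≤ envelope φ η :=
  le_csSup (bddAbove_aff_minorants φ h) ⟨σ, hσ, rfl⟩

theorem exists_le_of_lowerSemicontinuous (hφ : LowerSemicontinuous φ) : ∃ m, ∀ z, m ≤ φ z := by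
  obtain ⟨a, -, h⟩ := (hφ.lowerSemicontinuousOn univ).exists_isMinOn univ_nonempty isCompact_univ
  exact ⟨φ a, fun z => h (mem_univ z)⟩

theorem minorants_nonempty (hφ : LowerSemicontinuous φ) : (minorants φ).Nonempty := by
  obtain ⟨m, hm⟩ := exists_le_of_lowerSemicontinuous hφ
  obtain ⟨σ, hσ⟩ := exists_forall_aff_eq 0 m
  exact ⟨σ, fun z => by simpa [hσ] using hm z⟩

theorem envelope_le (hφ : LowerSemicontinuous φ) {η : ℂ} {M : ℝ}
    (h : ∀ σ ∈ minorants φ, aff σ η ≤ M) : envelope φ η ≤ M := by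
  refine csSup_le ((minorants_nonempty hφ).image _) ?_
  rintro _ ⟨σ, hσ, rfl⟩
  exact h σ hσ

theorem convexOn_envelope (hφ : LowerSemicontinuous φ) :
    ConvexOn ℝ (Metric.closedBall 0 1) (envelope φ) := by
  refine ⟨convex_closedBall _ _, fun x hx y hy a b ha hb hab => envelope_le hφ fun σ hσ => ?_⟩
  rw [aff_combo σ x y hab, smul_eq_mul, smul_eq_mul]
  have h1 := mul_le_mul_of_nonneg_left (aff_le_envelope hσ (mem_closedBall_zero_iff.1 hx)) ha
  have h2 := mul_le_mul_of_nonneg_left (aff_le_envelope hσ (mem_closedBall_zero_iff.1 hy)) hb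
  linarith

theorem Disc_subset_closedBall : Disc ⊆ Metric.closedBall 0 1 := Metric.ball_subset_closedBall

theorem continuousOn_envelope (hφ : LowerSemicontinuous φ) : ContinuousOn (envelope φ) Disc :=
  ((convexOn_envelope hφ).subset Disc_subset_closedBall convex_Disc).continuousOn isOpen_Disc

/-! ### Boundary values, support planes and radial limits -/

theorem coe_mem_closedBall (z : Circle) : (z : ℂ) ∈ Metric.closedBall (0 : ℂ) 1 :=
  mem_closedBall_zero_iff.2 (Circle.norm_coe z).le

/-- Points of the circle are strictly exposed: some affine function equals `-‖w - z‖² / 2` there. A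
large multiple of it, added to the constant `y`, stays below `φ` near `z` by semicontinuity and
elsewhere by the lower bound `m`. -/
theorem exists_minorant_gt (hφ : LowerSemicontinuous φ) (z : Circle) {y : ℝ} (hy : y < φ z) :
    ∃ σ ∈ minorants φ, aff σ z = y := by
  obtain ⟨m, hm⟩ := exists_le_of_lowerSemicontinuous hφ
  have hτ : ∀ w : Circle, aff ![1, (z : ℂ).re, (z : ℂ).im] w = -(‖(w : ℂ) - z‖ ^ 2 / 2) := by
    intro w
    have h1 := Circle.normSq_coe z
    have h2 := Circle.normSq_coe w
    rw [Complex.normSq_apply] at h1 h2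
    rw [Complex.sq_norm, Complex.normSq_apply, aff_eq]
    simp
    linear_combination (1 / 2) * h1 + (1 / 2) * h2
  obtain ⟨δ, hδ, hδ'⟩ := Metric.eventually_nhds_iff.1 (hφ z y hy)
  -- Chosen so that the drop at distance `δ` from `z` is exactly `|y - m|`.
  set M := 2 * |y - m| / δ ^ 2 with hM
  have hM0 : 0 ≤ M := by positivity
  obtain ⟨κ, hκ⟩ := exists_forall_aff_eq 0 y
  refine ⟨κ + M • ![1, (z : ℂ).re, (z : ℂ).im], fun w => ?_, ?_⟩
  · rw [aff_add, aff_smul, hκ, hτ]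
    simp only [zero_apply, zero_add]
    by_cases hw : dist w z < δ
    · have := (hδ' hw).le
      have h2 : 0 ≤ M * (‖(w : ℂ) - z‖ ^ 2 / 2) := by positivity
      linarith
    · have hw : δ ≤ ‖(w : ℂ) - z‖ := by
        rw [← dist_eq_norm]
        exact not_lt.1 hw
      have h3 : M * (δ ^ 2 / 2) ≤ M * (‖(w : ℂ) - z‖ ^ 2 / 2) := by gcongr
      have h4 : M * (δ ^ 2 / 2) = |y - m| := by rw [hM]; field_simp
      linarith [hm w, le_abs_self (y - m)]
  · rw [aff_add, aff_smul, hκ, hτ]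
    simp

theorem envelope_coe (hφ : LowerSemicontinuous φ) (z : Circle) : envelope φ z = φ z := by
  refine le_antisymm (envelope_le hφ fun σ hσ => hσ z) (le_of_forall_lt fun y hy => ?_)
  obtain ⟨y', h1, h2⟩ := exists_between hy
  obtain ⟨σ, hσ, h⟩ := exists_minorant_gt hφ z h2
  exact h1.trans_le (h ▸ aff_le_envelope hσ (Circle.norm_coe z).le)

theorem combo_mem_Disc (z : Circle) {x : ℂ} (hx : x ∈ Disc) {s : ℝ} (h0 : 0 < s) (h1 : s ≤ 1) :
    (1 - s) • (z : ℂ) + s • x ∈ Disc := by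
  rw [mem_Disc] at hx ⊢
  calc ‖(1 - s) • (z : ℂ) + s • x‖ ≤ ‖(1 - s) • (z : ℂ)‖ + ‖s • x‖ := norm_add_le _ _
    _ = (1 - s) + s * ‖x‖ := by
      rw [norm_smul, norm_smul, Circle.norm_coe, Real.norm_of_nonneg (by linarith),
        Real.norm_of_nonneg h0.le, mul_one]
    _ < 1 := by nlinarith

/-- Convexity bounds the envelope along the radius to `z` by interpolation between `φ z` and its
value at `0`; an excess of `σ` at `z` would break this bound near `z`. -/
theorem mem_minorants_of_aff_le_envelope (hφ : LowerSemicontinuous φ) {σ : Mink}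
    (h : ∀ x ∈ Disc, aff σ x ≤ envelope φ x) : σ ∈ minorants φ := by
  intro z
  by_contra! hc
  have h0 : (0 : ℂ) ∈ Disc := by simp [Disc]
  have hK := h 0 h0
  set d := aff σ z - φ z
  set K := envelope φ 0 - aff σ 0 with hKd
  have hd : 0 < d := sub_pos.2 hc
  have hK0 : 0 ≤ K := sub_nonneg.2 hK
  -- Small enough that `s * K < d / 2 ≤ (1 - s) * d`.
  set s := d / (2 * (d + K + 1)) with hs
  have hs0 : 0 < s := by positivity
  have hs1 : s ≤ 1 / 2 := by
    rw [hs, div_le_div_iff₀ (by positivity) (by positivity)]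
    linarith
  have hsK : s * K < d / 2 := by
    have : s * (d + K + 1) = d / 2 := by rw [hs]; field_simp
    nlinarith
  have e1 := h _ (combo_mem_Disc z h0 hs0 (by linarith))
  have e2 := (convexOn_envelope hφ).2 (coe_mem_closedBall z) (Disc_subset_closedBall h0)
    (show 0 ≤ 1 - s by linarith) hs0.le (by ring)
  rw [aff_combo σ _ _ (by ring)] at e1
  rw [envelope_coe hφ, smul_eq_mul, smul_eq_mul] at e2
  have e3 : (1 - s) * d ≤ s * K := by
    simp only [d, hKd]
    linarith
  nlinarith

/-- Hahn–Banach separates the open strict epigraph from the point of the graph over `η`. The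
separating plane is not vertical, since points straight above that point lie in the epigraph. -/
theorem exists_support (hφ : LowerSemicontinuous φ) {η : ℂ} (hη : η ∈ Disc) :
    ∃ σ ∈ minorants φ, aff σ η = envelope φ η := by
  have hconv : Convex ℝ {p : ℂ × ℝ | p.1 ∈ Disc ∧ envelope φ p.1 < p.2} :=
    ((convexOn_envelope hφ).subset Disc_subset_closedBall convex_Disc).convex_strict_epigraph
  have hopen : IsOpen {p : ℂ × ℝ | p.1 ∈ Disc ∧ envelope φ p.1 < p.2} := by
    have hc : ContinuousOn (fun p : ℂ × ℝ => p.2 - envelope φ p.1) (Prod.fst ⁻¹' Disc) :=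
      continuousOn_snd.sub ((continuousOn_envelope hφ).comp continuousOn_fst fun _ hp => hp)
    have := hc.isOpen_inter_preimage (isOpen_Disc.preimage continuous_fst) (isOpen_Ioi (a := 0))
    convert this using 1
    ext p
    simp
  obtain ⟨f, hf⟩ := geometric_hahn_banach_open_point hconv hopen
    (x := (η, envelope φ η)) (fun h => lt_irrefl _ h.2)
  have hfe : ∀ x t, f (x, t) = f (x, 0) + t * f (0, 1) := by
    intro x t
    rw [← smul_eq_mul, ← map_smul, ← map_add]
    simp
  set c := f (0, 1)
  have hc : c < 0 := by
    have := hf (η, envelope φ η + 1) ⟨hη, by simp⟩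
    rw [hfe, hfe η (envelope φ η)] at this
    linarith
  have hc' : c ≠ 0 := hc.ne
  have hle : ∀ x ∈ Disc, f (x, 0) + envelope φ x * c ≤ f (η, 0) + envelope φ η * c := by
    intro x hx
    refine le_of_forall_pos_lt_add fun ε hε => ?_
    have := hf (x, envelope φ x + ε / (-c)) ⟨hx, by
      have : 0 < ε / (-c) := div_pos hε (neg_pos.2 hc)
      simpa using this⟩
    rw [hfe, hfe η (envelope φ η)] at this
    have h2 : ε / (-c) * c = -ε := by field_simp
    linarith
  obtain ⟨σ, hσ⟩ := exists_forall_aff_eq ((-c)⁻¹ • f.comp (ContinuousLinearMap.inl ℝ ℂ ℝ))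
    (envelope φ η - (-c)⁻¹ * f (η, 0))
  have hσ' : ∀ x, aff σ x = (-c)⁻¹ * f (x, 0) + (envelope φ η - (-c)⁻¹ * f (η, 0)) := by
    intro x
    rw [hσ]
    simp
  refine ⟨σ, mem_minorants_of_aff_le_envelope hφ fun x hx => ?_, by rw [hσ']; ring⟩
  have h1 := mul_le_mul_of_nonneg_left (hle x hx) (inv_nonneg.2 (neg_pos.2 hc).le)
  have h2 : ∀ t : ℝ, (-c)⁻¹ * (t * c) = -t := fun t => by field_simp
  rw [mul_add, mul_add, h2, h2] at h1
  rw [hσ']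
  linarith

/-- Affine minorants nearly touching `φ` at `z` bound the limit from below; convexity on the segment
from `z` to `x` bounds it from above. -/
theorem tendsto_envelope_radial (hφ : LowerSemicontinuous φ) (z : Circle) {x : ℂ}
    (hx : x ∈ Disc) :
    Tendsto (fun s : ℝ => envelope φ ((1 - s) • (z : ℂ) + s • x)) (𝓝[>] 0) (𝓝 (φ z)) := by
  have hev : ∀ᶠ s : ℝ in 𝓝[>] 0, 0 < s ∧ s ≤ 1 := by
    filter_upwards [Ioc_mem_nhdsGT (zero_lt_one' ℝ)] with s hs using hs
  refine tendsto_order.2 ⟨fun y hy => ?_, fun y hy => ?_⟩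
  · obtain ⟨y', h1, h2⟩ := exists_between hy
    obtain ⟨σ, hσ, h⟩ := exists_minorant_gt hφ z h2
    have ht : Tendsto (fun s : ℝ => aff σ ((1 - s) • (z : ℂ) + s • x)) (𝓝[>] 0) (𝓝 y') := by
      have hc : Continuous fun s : ℝ => aff σ ((1 - s) • (z : ℂ) + s • x) :=
        (continuous_aff σ).comp (by fun_prop)
      have := hc.tendsto 0
      simp only [sub_zero, one_smul, zero_smul, add_zero, h] at this
      exact this.mono_left nhdsWithin_le_nhds
    filter_upwards [ht.eventually_const_lt h1, hev] with s hs1 hs2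
    exact hs1.trans_le
      (aff_le_envelope hσ (mem_Disc.1 (combo_mem_Disc z hx hs2.1 hs2.2)).le)
  · have ht : Tendsto (fun s : ℝ => (1 - s) * φ z + s * envelope φ x) (𝓝[>] 0) (𝓝 (φ z)) := by
      have hc : Continuous fun s : ℝ => (1 - s) * φ z + s * envelope φ x := by fun_prop
      have := hc.tendsto 0
      simp at this
      exact this.mono_left nhdsWithin_le_nhds
    filter_upwards [ht.eventually_lt_const hy, hev] with s hs1 hs2
    have := (convexOn_envelope hφ).2 (coe_mem_closedBall z) (Disc_subset_closedBall hx)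
      (sub_nonneg.2 hs2.2) hs2.1.le (by ring)
    rw [envelope_coe hφ, smul_eq_mul, smul_eq_mul] at this
    linarith

/-- Along a radial path, the gradients of the support planes of the envelope are negligible against
the inverse of the distance to the boundary. -/
theorem tendsto_mul_norm_gradient_radial (hφ : LowerSemicontinuous φ) (z : Circle) {x : ℂ}
    (hx : x ∈ Disc) {σ : ℂ → Mink} (hσ : ∀ η ∈ Disc, σ η ∈ minorants φ)
    (hσ' : ∀ η ∈ Disc, aff (σ η) η = envelope φ η) :
    Tendsto (fun s : ℝ => s * ‖(⟨σ ((1 - s) • (z : ℂ) + s • x) 1,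
      σ ((1 - s) • (z : ℂ) + s • x) 2⟩ : ℂ)‖) (𝓝[>] 0) (𝓝 0) := by
  have hev : ∀ᶠ s : ℝ in 𝓝[>] 0, 0 < s ∧ s ≤ 1 := by
    filter_upwards [Ioc_mem_nhdsGT (zero_lt_one' ℝ)] with s hs using hs
  set r := (1 - ‖x‖) / 2 with hr
  have hr0 : 0 < r := by have := mem_Disc.1 hx; linarith
  have hsub : Metric.closedBall x r ⊆ Disc := fun y hy => by
    rw [Metric.mem_closedBall, dist_eq_norm] at hy
    have := norm_le_norm_add_norm_sub' y x
    have := mem_Disc.1 hx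
    rw [mem_Disc]
    linarith
  obtain ⟨y, -, hy⟩ := (isCompact_closedBall x r).exists_isMaxOn
    (Metric.nonempty_closedBall.2 hr0.le) ((continuousOn_envelope hφ).mono hsub)
  set M := envelope φ y
  have hlim : Tendsto (fun s : ℝ => (((1 - s) * φ z + s * M) -
      envelope φ ((1 - s) • (z : ℂ) + s • x)) / r) (𝓝[>] 0) (𝓝 0) := by
    have hc : Continuous fun s : ℝ => (1 - s) * φ z + s * M := by fun_prop
    have h1 := hc.tendsto 0
    have h2 := ((h1.mono_left nhdsWithin_le_nhds).sub
      (tendsto_envelope_radial hφ z hx)).div_const r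
    simpa using h2
  refine squeeze_zero' (hev.mono fun s hs => mul_nonneg hs.1.le (norm_nonneg _)) ?_ hlim
  filter_upwards [hev] with s hs
  set η := (1 - s) • (z : ℂ) + s • x with hη
  have hηD : η ∈ Disc := combo_mem_Disc z hx hs.1 hs.2
  set g : ℂ := ⟨σ η 1, σ η 2⟩ with hg
  rw [le_div_iff₀ hr0]
  -- Replacing `x` by `x + r • v`, with `v` along the gradient, raises the support plane by `s * r *
  -- ‖g‖`. Convexity still bounds the envelope at the new point by `(1 - s) * φ z + s * M`.
  obtain ⟨v, hv, hgv⟩ : ∃ v : ℂ, ‖v‖ ≤ 1 ∧ g.re * v.re + g.im * v.im = ‖g‖ := by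
    refine ⟨(‖g‖⁻¹ : ℝ) • g, ?_, ?_⟩
    · rw [norm_smul, norm_inv, norm_norm]
      exact inv_mul_le_one
    · have h2 := Complex.sq_norm g
      rw [Complex.normSq_apply] at h2
      rcases eq_or_ne g 0 with h | h
      · simp [h]
      · have : ‖g‖ ≠ 0 := norm_ne_zero_iff.2 h
        simp only [Complex.smul_re, Complex.smul_im, smul_eq_mul]
        field_simp
        linarith
  have hxv : x + r • v ∈ Metric.closedBall x r := by
    rw [Metric.mem_closedBall, dist_eq_norm, add_sub_cancel_left, norm_smul,
      Real.norm_of_nonneg hr0.le]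
    nlinarith
  have hM : envelope φ (x + r • v) ≤ M := hy hxv
  have h1 := (convexOn_envelope hφ).2 (coe_mem_closedBall z)
    (Disc_subset_closedBall (hsub hxv)) (sub_nonneg.2 hs.2) hs.1.le (by ring)
  have h2 := aff_le_envelope (hσ η hηD)
    (mem_Disc.1 (combo_mem_Disc z (hsub hxv) hs.1 hs.2)).le
  have h3 : aff (σ η) ((1 - s) • (z : ℂ) + s • (x + r • v)) =
      envelope φ η + s * r * ‖g‖ := by
    have key : ∀ τ : Mink, aff τ ((1 - s) • (z : ℂ) + s • (x + r • v)) =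
        aff τ ((1 - s) • (z : ℂ) + s • x) + s * r * (τ 1 * v.re + τ 2 * v.im) := by
      intro τ
      rw [aff_eq, aff_eq]
      simp
      ring
    rw [← hσ' η hηD, ← hgv, key]
  rw [envelope_coe hφ, smul_eq_mul, smul_eq_mul] at h1
  have h4 := mul_le_mul_of_nonneg_left hM hs.1.le
  linarith

/-- A choice of support planes of the envelope defines a vector field that extends radially. -/
theorem tendsto_killing_radial (hφ : LowerSemicontinuous φ) (z : Circle) {x : ℂ}
    (hx : x ∈ Disc) {σ : ℂ → Mink} (hσ : ∀ η ∈ Disc, σ η ∈ minorants φ)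
    (hσ' : ∀ η ∈ Disc, aff (σ η) η = envelope φ η) :
    Tendsto (fun s : ℝ => killing (Lam (σ ((1 - s) • (z : ℂ) + s • x)))
      ((1 - s) • (z : ℂ) + s • x)) (𝓝[>] 0) (𝓝 ((φ z : ℂ) * (Complex.I * z))) := by
  have hev : ∀ᶠ s : ℝ in 𝓝[>] 0, 0 < s ∧ s ≤ 1 := by
    filter_upwards [Ioc_mem_nhdsGT (zero_lt_one' ℝ)] with s hs using hs
  have hpath : Tendsto (fun s : ℝ => (1 - s) • (z : ℂ) + s • x) (𝓝[>] 0) (𝓝 (z : ℂ)) := by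
    have hc : Continuous fun s : ℝ => (1 - s) • (z : ℂ) + s • x := by fun_prop
    have := hc.tendsto 0
    simp only [sub_zero, one_smul, zero_smul, add_zero] at this
    exact this.mono_left nhdsWithin_le_nhds
  have h1 : Tendsto (fun s : ℝ => Complex.I * ((1 - s) • (z : ℂ) + s • x) *
      (envelope φ ((1 - s) • (z : ℂ) + s • x) : ℂ)) (𝓝[>] 0)
      (𝓝 (Complex.I * z * (φ z : ℂ))) :=
    (hpath.const_mul _).mul
      ((Complex.continuous_ofReal.tendsto _).comp (tendsto_envelope_radial hφ z hx))
  have h2 : Tendsto (fun s : ℝ => Complex.I * ((1 - ‖(1 - s) • (z : ℂ) + s • x‖ ^ 2 : ℝ) : ℂ) *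
      (⟨σ ((1 - s) • (z : ℂ) + s • x) 1, σ ((1 - s) • (z : ℂ) + s • x) 2⟩ : ℂ))
      (𝓝[>] 0) (𝓝 0) := by
    -- The factor 4 comes from `1 - ‖η‖ ≤ s * ‖z - x‖ ≤ 2 * s` and `1 + ‖η‖ ≤ 2`.
    have hlim := (tendsto_mul_norm_gradient_radial hφ z hx hσ hσ').const_mul 4
    rw [mul_zero] at hlim
    refine squeeze_zero_norm' ?_ hlim
    filter_upwards [hev] with s hs
    have hD := (mem_Disc.1 (combo_mem_Disc z hx hs.1 hs.2)).le
    set η := (1 - s) • (z : ℂ) + s • x with hη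
    have hz1 : (z : ℂ) = η + s • (z - x) := by
      rw [hη]
      module
    have hn : 1 ≤ ‖η‖ + s * 2 := by
      have e1 : ‖(z : ℂ)‖ ≤ ‖η‖ + ‖s • ((z : ℂ) - x)‖ := by
        conv_lhs => rw [hz1]
        exact norm_add_le _ _
      have e2 : ‖(z : ℂ) - x‖ ≤ 2 := by
        have := norm_sub_le (z : ℂ) x
        have := mem_Disc.1 hx
        rw [Circle.norm_coe] at *
        linarith
      rw [norm_smul, Real.norm_of_nonneg hs.1.le, Circle.norm_coe] at e1
      nlinarith [hs.1]
    rw [norm_mul, norm_mul, Complex.norm_I, one_mul, Complex.norm_real,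
      Real.norm_of_nonneg (by nlinarith [norm_nonneg η]), ← mul_assoc]
    gcongr
    nlinarith [norm_nonneg η]
  have h3 := h1.add h2
  rw [add_zero, show Complex.I * z * (φ z : ℂ) = (φ z : ℂ) * (Complex.I * z) by ring] at h3
  refine h3.congr' ?_
  filter_upwards [hev] with s hs
  rw [killing_Lam, hσ' _ (combo_mem_Disc z hx hs.1 hs.2)]

/-! ### The faces of the envelope -/

/-- The points of the circle where the affine function of `σ` touches `φ`. -/
def contact (φ : Circle → ℝ) (σ : Mink) : Set ℂ := (↑) '' {z : Circle | φ z ≤ aff σ z}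

/-- The points of the disc where the affine function of `σ` touches the envelope. -/
def face (φ : Circle → ℝ) (σ : Mink) : Set ℂ := {η | η ∈ Disc ∧ envelope φ η ≤ aff σ η}

theorem convex_setOf_envelope_le (hφ : LowerSemicontinuous φ) (σ : Mink) :
    Convex ℝ {η ∈ Metric.closedBall (0 : ℂ) 1 | envelope φ η ≤ aff σ η} := by
  have h := ((convexOn_envelope hφ).sub (concaveOn_aff σ (convex_closedBall 0 1))).convex_le 0
  convert h using 3
  simp

theorem face_subset_Disc (φ : Circle → ℝ) (σ : Mink) : face φ σ ⊆ Disc := fun _ h => h.1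

theorem convex_face (hφ : LowerSemicontinuous φ) (σ : Mink) : Convex ℝ (face φ σ) := by
  convert convex_Disc.inter (convex_setOf_envelope_le hφ σ) using 1
  ext η
  exact ⟨fun h => ⟨h.1, Disc_subset_closedBall h.1, h.2⟩, fun h => ⟨h.1, h.2.2⟩⟩

theorem convexHull_contact_inter_subset_face (hφ : LowerSemicontinuous φ) (σ : Mink) :
    convexHull ℝ (contact φ σ) ∩ Disc ⊆ face φ σ := by
  rintro η ⟨h1, h2⟩
  refine ⟨h2, (convexHull_min ?_ (convex_setOf_envelope_le hφ σ) h1).2⟩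
  rintro _ ⟨z, hz, rfl⟩
  exact ⟨coe_mem_closedBall z, (envelope_coe hφ z).le.trans hz⟩

theorem envelope_eq_of_mem_face {σ : Mink} (hσ : σ ∈ minorants φ) {η : ℂ} (h : η ∈ face φ σ) :
    aff σ η = envelope φ η :=
  le_antisymm (aff_le_envelope hσ (mem_Disc.1 h.1).le) h.2

theorem isCompact_contact (hφ : LowerSemicontinuous φ) (σ : Mink) :
    IsCompact (contact φ σ) := by
  refine IsCompact.image (IsClosed.isCompact ?_) continuous_subtype_val
  have h : LowerSemicontinuous fun z : Circle => φ z + -aff σ z :=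
    hφ.add ((continuous_aff σ).comp continuous_subtype_val).neg.lowerSemicontinuous
  convert h.isClosed_preimage 0 using 1
  ext z
  simp

/-- Otherwise an affine `τ` is positive at `η` and negative on the contact set. On the part of the
circle where `τ ≥ 0`, the gap `φ - σ` has a positive minimum, so `σ + ε τ` is still a minorant for
small `ε`, yet exceeds the envelope at `η`. -/
theorem face_subset_convexHull_contact (hφ : LowerSemicontinuous φ) {σ : Mink}
    (hσ : σ ∈ minorants φ) : face φ σ ⊆ convexHull ℝ (contact φ σ) := by
  intro η hη
  by_contra hc
  obtain ⟨f, c, hf1, hf2⟩ := geometric_hahn_banach_closed_point (convex_convexHull ℝ _)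
    (isCompact_convexHull_of_isCompact (isCompact_contact hφ σ)).isClosed hc
  obtain ⟨τ, hτ⟩ := exists_forall_aff_eq f (-c)
  have hneg : ∀ z : Circle, φ z ≤ aff σ z → aff τ z < 0 := fun z hz => by
    have := hf1 z (subset_convexHull ℝ _ ⟨z, hz, rfl⟩)
    rw [hτ]
    linarith
  have hpos : 0 < aff τ η := by rw [hτ]; linarith
  obtain ⟨ε, hε, hε'⟩ : ∃ ε : ℝ, 0 < ε ∧ σ + ε • τ ∈ minorants φ := by
    set K : Set Circle := {z | 0 ≤ aff τ z}
    have hcτ : Continuous fun z : Circle => aff τ z :=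
      (continuous_aff τ).comp continuous_subtype_val
    have hK : IsCompact K := (isClosed_le continuous_const hcτ).isCompact
    rcases K.eq_empty_or_nonempty with hKe | hKn
    · refine ⟨1, one_pos, fun z => ?_⟩
      have : z ∉ K := by simp [hKe]
      have : aff τ z < 0 := not_le.1 this
      rw [one_smul, aff_add]
      linarith [hσ z]
    · have hl : LowerSemicontinuous fun z : Circle => φ z + -aff σ z :=
        hφ.add ((continuous_aff σ).comp continuous_subtype_val).neg.lowerSemicontinuous
      obtain ⟨a, ha, hmin⟩ := (hl.lowerSemicontinuousOn K).exists_isMinOn hKn hK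
      obtain ⟨b, hb, hmax⟩ := hK.exists_isMaxOn hKn hcτ.continuousOn
      have hma : 0 < φ a + -aff σ a := by
        by_contra hh
        have h1 := hneg a (by linarith)
        have h2 : 0 ≤ aff τ a := ha
        linarith
      have hb0 : 0 ≤ aff τ b := hb
      -- The least gap over the largest value of `τ` on `K`; adding 1 keeps the denominator
      -- positive.
      refine ⟨(φ a + -aff σ a) / (aff τ b + 1), by positivity, fun z => ?_⟩
      set ε := (φ a + -aff σ a) / (aff τ b + 1) with hεd
      have hε : 0 < ε := by positivity
      rw [aff_add, aff_smul]
      by_cases hz : z ∈ K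
      · have h1 : φ a + -aff σ a ≤ φ z + -aff σ z := hmin hz
        have h2 : aff τ z ≤ aff τ b := hmax hz
        have h3 : ε * (aff τ b + 1) = φ a + -aff σ a := by rw [hεd]; field_simp
        nlinarith
      · have : aff τ z < 0 := not_le.1 hz
        nlinarith [hσ z]
  have h1 := aff_le_envelope hε' (mem_Disc.1 hη.1).le
  rw [aff_add, aff_smul, envelope_eq_of_mem_face hσ hη] at h1
  nlinarith

/-! ### The lamination of a lower semicontinuous function -/

/-- Near `η` the difference is the envelope minus the function of `τ`: it is nonnegative and
vanishes at `η`. -/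
theorem eq_of_mem_interior_face {σ τ : Mink} (hσ : σ ∈ minorants φ) (hτ : τ ∈ minorants φ) {η : ℂ}
    (h1 : η ∈ interior (face φ σ)) (h2 : η ∈ face φ τ) : σ = τ := by
  have h1' := interior_subset h1
  refine sub_eq_zero.1 (eq_zero_of_aff_eq_zero_of_nonneg (x := η) ?_ ?_)
  · rw [aff_sub, envelope_eq_of_mem_face hσ h1', envelope_eq_of_mem_face hτ h2, sub_self]
  · filter_upwards [mem_interior_iff_mem_nhds.1 h1] with y hy
    rw [aff_sub, envelope_eq_of_mem_face hσ hy, sub_nonneg]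
    exact aff_le_envelope hτ (mem_Disc.1 hy.1).le

/-- Positive barycentric coordinates place the point inside a triangle of contact points, whose part
in the disc lies in the face. -/
theorem mem_interior_face_of_affineIndependent (hφ : LowerSemicontinuous φ) {σ : Mink}
    {ι : Type*} [Fintype ι] {z : ι → ℂ} {w : ι → ℝ} (hz : Set.range z ⊆ contact φ σ)
    (hi : AffineIndependent ℝ z) (hcard : Fintype.card ι = 3) (hw : ∀ i, 0 < w i)
    (hw1 : ∑ i, w i = 1) (hD : ∑ i, w i • z i ∈ Disc) :
    ∑ i, w i • z i ∈ interior (face φ σ) := by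
  let b : AffineBasis ι ℝ ℂ := ⟨z, hi, by
    rw [hi.affineSpan_eq_top_iff_card_eq_finrank_add_one, hcard, Complex.finrank_real_complex]⟩
  have hb : ∑ i, w i • z i ∈ interior (convexHull ℝ (Set.range b)) := by
    rw [b.interior_convexHull]
    intro i
    have h1 : ∑ i, w i • z i = Finset.univ.affineCombination ℝ b w :=
      (Finset.affineCombination_eq_linear_combination _ _ _ hw1).symm
    rw [h1, b.coord_apply_combination_of_mem (Finset.mem_univ i) hw1]
    exact hw i
  have hsub : interior (convexHull ℝ (Set.range b)) ∩ Disc ⊆ face φ σ :=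
    Subset.trans (inter_subset_inter_left _ (interior_subset.trans (convexHull_mono hz)))
      (convexHull_contact_inter_subset_face hφ σ)
  exact interior_maximal hsub (isOpen_interior.inter isOpen_Disc) ⟨hb, hD⟩

theorem coe_circle_ne {z w : Circle} (h : z ≠ w) : (z : ℂ) ≠ w := fun h' => h (Circle.ext h')

theorem geod_subset_Disc {p : Circle × Circle} (h : p.1 ≠ p.2) : geod p ⊆ Disc := by
  have := (strictConvex_closedBall ℝ (0 : ℂ) 1).openSegment_subset (coe_mem_closedBall p.1)
    (coe_mem_closedBall p.2) (coe_circle_ne h)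
  rwa [interior_closedBall _ one_ne_zero] at this

theorem geod_swap (p : Circle × Circle) : geod p.swap = geod p := openSegment_symm ℝ _ _

theorem midpoint_mem_geod (p : Circle × Circle) :
    (1 / 2 : ℝ) • (p.1 : ℂ) + (1 / 2 : ℝ) • (p.2 : ℂ) ∈ geod p :=
  ⟨1 / 2, 1 / 2, by norm_num, by norm_num, by norm_num, rfl⟩

theorem geod_subset_face (hφ : LowerSemicontinuous φ) {σ : Mink} {p : Circle × Circle}
    (hp : p.1 ≠ p.2) (h1 : φ p.1 ≤ aff σ p.1) (h2 : φ p.2 ≤ aff σ p.2) : geod p ⊆ face φ σ := by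
  refine Subset.trans (subset_inter ?_ (geod_subset_Disc hp))
    (convexHull_contact_inter_subset_face hφ σ)
  exact (openSegment_subset_segment ℝ _ _).trans
    (segment_subset_convexHull ⟨p.1, h1, rfl⟩ ⟨p.2, h2, rfl⟩)

/-- Three distinct points of a circle are affinely independent, so a third contact point fattens the
face. -/
theorem add_half_mem_interior_face (hφ : LowerSemicontinuous φ) {σ : Mink} {p : Circle × Circle}
    (hp : p.1 ≠ p.2) (h1 : φ p.1 ≤ aff σ p.1) (h2 : φ p.2 ≤ aff σ p.2) {z : Circle}
    (h : φ z ≤ aff σ z) (hz1 : z ≠ p.1) (hz2 : z ≠ p.2) {η : ℂ} (hη : η ∈ geod p) :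
    (1 / 2 : ℝ) • (z : ℂ) + (1 / 2 : ℝ) • η ∈ interior (face φ σ) := by
  have hD : (1 / 2 : ℝ) • (z : ℂ) + (1 / 2 : ℝ) • η ∈ Disc := by
    have := combo_mem_Disc z (geod_subset_Disc hp hη) (s := 1 / 2) (by norm_num) (by norm_num)
    rwa [show (1 - 1 / 2 : ℝ) = 1 / 2 by norm_num] at this
  obtain ⟨a, b, ha, hb, hab, rfl⟩ := hη
  have hc : EuclideanGeometry.Cospherical ({(z : ℂ), (p.1 : ℂ), (p.2 : ℂ)} : Set ℂ) := by
    refine ⟨0, 1, ?_⟩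
    simp only [mem_insert_iff, mem_singleton_iff, forall_eq_or_imp, forall_eq, dist_zero_right]
    exact ⟨Circle.norm_coe z, Circle.norm_coe p.1, Circle.norm_coe p.2⟩
  have hi := hc.affineIndependent_of_ne (coe_circle_ne hz1) (coe_circle_ne hz2) (coe_circle_ne hp)
  have hs : ∑ i, (![1 / 2, a / 2, b / 2] : Fin 3 → ℝ) i • (![(z : ℂ), p.1, p.2] : Fin 3 → ℂ) i =
      (1 / 2 : ℝ) • (z : ℂ) + (1 / 2 : ℝ) • (a • (p.1 : ℂ) + b • (p.2 : ℂ)) := by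
    rw [Fin.sum_univ_three]
    simp only [Matrix.cons_val]
    module
  rw [← hs] at hD ⊢
  refine mem_interior_face_of_affineIndependent hφ ?_ hi (by simp) ?_ ?_ hD
  · rintro _ ⟨i, rfl⟩
    fin_cases i
    · exact ⟨z, h, rfl⟩
    · exact ⟨p.1, h1, rfl⟩
    · exact ⟨p.2, h2, rfl⟩
  · intro i
    fin_cases i
    · norm_num
    · exact half_pos ha
    · exact half_pos hb
  · rw [Fin.sum_univ_three]
    simp only [Matrix.cons_val]
    linarith

/-- The points of the disc near which the envelope is affine. -/
def flat (φ : Circle → ℝ) : Set ℂ := ⋃ σ ∈ minorants φ, interior (face φ σ)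

theorem mem_flat {η : ℂ} : η ∈ flat φ ↔ ∃ σ ∈ minorants φ, η ∈ interior (face φ σ) := by
  simp [flat]

theorem isOpen_flat (φ : Circle → ℝ) : IsOpen (flat φ) :=
  isOpen_biUnion fun _ _ => isOpen_interior

theorem flat_subset_Disc (φ : Circle → ℝ) : flat φ ⊆ Disc :=
  iUnion₂_subset fun σ _ => interior_subset.trans (face_subset_Disc φ σ)

/-- The pairs of points of the circle that span a geodesic on which the envelope is affine and near
no point of which the envelope is affine. -/
def leafSet (φ : Circle → ℝ) : Set (Circle × Circle) :=
  {p | p.1 ≠ p.2 ∧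
    φ p.1 + φ p.2 ≤ 2 * envelope φ ((1 / 2 : ℝ) • (p.1 : ℂ) + (1 / 2 : ℝ) • (p.2 : ℂ)) ∧
    Disjoint (geod p) (flat φ)}

/-- A support plane `τ` at the midpoint must agree with `φ` at both ends. At `η` the plane `σ` is at
least as high as `τ`, while at the ends it is at most `φ`, hence equal to it. -/
theorem contact_of_mem_leafSet (hφ : LowerSemicontinuous φ) {σ : Mink} (hσ : σ ∈ minorants φ)
    {p : Circle × Circle} (hp : p ∈ leafSet φ) {η : ℂ} (hη : η ∈ geod p) (hf : η ∈ face φ σ) :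
    φ p.1 ≤ aff σ p.1 ∧ φ p.2 ≤ aff σ p.2 := by
  obtain ⟨hne, hle, -⟩ := hp
  obtain ⟨τ, hτ, hτe⟩ := exists_support hφ (geod_subset_Disc hne (midpoint_mem_geod p))
  rw [← hτe, aff_combo τ _ _ (by norm_num)] at hle
  have t1 := hτ p.1
  have t2 := hτ p.2
  have s1 := hσ p.1
  have s2 := hσ p.2
  have h1 := envelope_eq_of_mem_face hσ hf
  have h2 := aff_le_envelope hτ (mem_Disc.1 hf.1).le
  rw [← h1] at h2
  obtain ⟨a, b, ha, hb, hab, rfl⟩ := hη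
  rw [aff_combo τ _ _ hab, aff_combo σ _ _ hab] at h2
  have e1 : aff τ p.1 = φ p.1 := by linarith
  have e2 : aff τ p.2 = φ p.2 := by linarith
  rw [e1, e2] at h2
  constructor <;> nlinarith

/-- Write `η` as a combination of affinely independent contact points. One point would put `η` on
the circle and three would make it interior to the face, so there are two. If their chord met a face
interior, convexity would spread interiority along it to `η`. -/
theorem exists_mem_leafSet_of_notMem_flat (hφ : LowerSemicontinuous φ) {η : ℂ} (hη : η ∈ Disc)
    (hn : η ∉ flat φ) : ∃ p ∈ leafSet φ, η ∈ geod p := by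
  obtain ⟨σ, hσ, hση⟩ := exists_support hφ hη
  have hf : η ∈ face φ σ := ⟨hη, hση.ge⟩
  have hint : η ∉ interior (face φ σ) := fun h => hn (mem_flat.2 ⟨σ, hσ, h⟩)
  obtain ⟨ι, _, z, w, hz, hi, hw, hw1, hx⟩ :=
    eq_pos_convex_span_of_mem_convexHull (face_subset_convexHull_contact hφ hσ hf)
  have hcard : Fintype.card ι ≤ 3 := by
    have h1 := hi.card_le_finrank_succ
    have h2 := Submodule.finrank_le (vectorSpan ℝ (Set.range z))
    rw [Complex.finrank_real_complex] at h2
    omega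
  obtain ⟨p, hp, hc1, hc2, hηp⟩ : ∃ p : Circle × Circle, p.1 ≠ p.2 ∧ φ p.1 ≤ aff σ p.1 ∧
      φ p.2 ≤ aff σ p.2 ∧ η ∈ geod p := by
    have hsum := fun {n : ℕ} (e : ι ≃ Fin n) => e.symm.sum_comp w
    have hsum' := fun {n : ℕ} (e : ι ≃ Fin n) => e.symm.sum_comp fun i => w i • z i
    have hc : Fintype.card ι = 0 ∨ Fintype.card ι = 1 ∨ Fintype.card ι = 2 ∨
      Fintype.card ι = 3 := by omega
    rcases hc with h | h | h | h
    · have := hsum (Fintype.equivFinOfCardEq h)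
      rw [Fin.sum_univ_zero, hw1] at this
      exact absurd this zero_ne_one
    · have h1 := hsum (Fintype.equivFinOfCardEq h)
      have h2 := hsum' (Fintype.equivFinOfCardEq h)
      rw [Fin.sum_univ_one, hw1] at h1
      rw [Fin.sum_univ_one, hx, h1, one_smul] at h2
      obtain ⟨ζ, -, hζ⟩ := hz (mem_range_self ((Fintype.equivFinOfCardEq h).symm 0))
      rw [h2] at hζ
      rw [← hζ, mem_Disc, Circle.norm_coe] at hη
      exact absurd hη (lt_irrefl _)
    · set e := (Fintype.equivFinOfCardEq h).symm
      have h1 := hsum (Fintype.equivFinOfCardEq h)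
      have h2 := hsum' (Fintype.equivFinOfCardEq h)
      rw [Fin.sum_univ_two, hw1] at h1
      rw [Fin.sum_univ_two, hx] at h2
      obtain ⟨ζ₀, hζ₀, e₀⟩ := hz (mem_range_self (e 0))
      obtain ⟨ζ₁, hζ₁, e₁⟩ := hz (mem_range_self (e 1))
      refine ⟨(ζ₀, ζ₁), ?_, hζ₀, hζ₁, ?_⟩
      · rintro (rfl : ζ₀ = ζ₁)
        exact absurd (e.injective (hi.injective (e₀.symm.trans e₁))) (by decide)
      · refine ⟨w (e 0), w (e 1), hw _, hw _, h1, ?_⟩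
        change w (e 0) • (ζ₀ : ℂ) + w (e 1) • (ζ₁ : ℂ) = η
        rw [e₀, e₁]
        exact h2
    · exact absurd (hx ▸ mem_interior_face_of_affineIndependent hφ hz hi h hw hw1 (hx ▸ hη)) hint
  refine ⟨p, ⟨hp, ?_, ?_⟩, hηp⟩
  · have := aff_le_envelope hσ (mem_Disc.1 (geod_subset_Disc hp (midpoint_mem_geod p))).le
    rw [aff_combo σ _ _ (by norm_num)] at this
    linarith
  · refine disjoint_left.2 fun ξ hξ hξf => hint ?_
    obtain ⟨τ, hτ, hξτ⟩ := mem_flat.1 hξf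
    obtain rfl := eq_of_mem_interior_face hτ hσ hξτ (geod_subset_face hφ hp hc1 hc2 hξ)
    -- The contact set of `τ` with the envelope on the closed disc, which contains the ends of the
    -- chord.
    set B := {η ∈ Metric.closedBall (0 : ℂ) 1 | envelope φ η ≤ aff τ η}
    have hBf : interior B ∩ Disc ⊆ interior (face φ τ) :=
      interior_maximal (fun y hy => ⟨hy.2, (interior_subset hy.1).2⟩)
        (isOpen_interior.inter isOpen_Disc)
    have hfB : face φ τ ⊆ B := fun y hy => ⟨Disc_subset_closedBall hy.1, hy.2⟩
    have hξB : ξ ∈ interior B := interior_mono hfB hξτ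
    have hmem : ∀ z : Circle, φ z ≤ aff τ z → (z : ℂ) ∈ B := fun z hz =>
      ⟨coe_mem_closedBall z, (envelope_coe hφ z).le.trans hz⟩
    have hBc := convex_setOf_envelope_le hφ τ
    have hrange : ξ ∈ Set.range (AffineMap.lineMap (k := ℝ) (p.1 : ℂ) (p.2 : ℂ)) := by
      have h := hξ
      rw [geod, openSegment_eq_image_lineMap] at h
      exact image_subset_range _ _ h
    refine hBf ⟨?_, hη⟩
    rcases openSegment_subset_union _ _ hrange hηp with h | h | h
    · exact h ▸ hξB
    · rw [openSegment_symm] at h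
      exact hBc.openSegment_interior_self_subset_interior hξB (hmem _ hc1) h
    · exact hBc.openSegment_interior_self_subset_interior hξB (hmem _ hc2) h

/-- One support plane at the common point touches `φ` at all four ends. An end of `q` not shared
with `p` would make a point of `geod q` interior to a face. -/
theorem eq_or_eq_swap_of_mem_geod (hφ : LowerSemicontinuous φ) {p q : Circle × Circle}
    (hp : p ∈ leafSet φ) (hq : q ∈ leafSet φ) {η : ℂ} (h1 : η ∈ geod p) (h2 : η ∈ geod q) :
    q = p ∨ q = p.swap := by
  have hη := geod_subset_Disc hp.1 h1
  obtain ⟨σ, hσ, hση⟩ := exists_support hφ hη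
  have hf : η ∈ face φ σ := ⟨hη, hση.ge⟩
  obtain ⟨p1, p2⟩ := contact_of_mem_leafSet hφ hσ hp h1 hf
  obtain ⟨q1, q2⟩ := contact_of_mem_leafSet hφ hσ hq h2 hf
  have key : ∀ z : Circle, φ z ≤ aff σ z →
      (1 / 2 : ℝ) • (z : ℂ) + (1 / 2 : ℝ) • η ∈ geod q → z = p.1 ∨ z = p.2 := by
    intro z hz hg
    by_contra! hc
    exact disjoint_left.1 hq.2.2 hg (mem_flat.2
      ⟨σ, hσ, add_half_mem_interior_face hφ hp.1 p1 p2 hz hc.1 hc.2 h1⟩)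
  obtain ⟨a, b, ha, hb, hab, he⟩ := h2
  have k1 := key q.1 q1 ⟨1 / 2 + a / 2, b / 2, by positivity, by positivity, by linarith, by
    rw [← he]; module⟩
  have k2 := key q.2 q2 ⟨a / 2, 1 / 2 + b / 2, by positivity, by positivity, by linarith, by
    rw [← he]; module⟩
  have hne := hq.1
  rcases k1 with k1 | k1 <;> rcases k2 with k2 | k2
  · exact absurd (k1.trans k2.symm) hne
  · exact Or.inl (Prod.ext k1 k2)
  · exact Or.inr (Prod.ext k1 k2)
  · exact absurd (k1.trans k2.symm) hne

/-- Off the diagonal midpoints stay in the disc, where the envelope is continuous, so the inequality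
cuts out a sublevel set of a lower semicontinuous function. Avoiding the open set `flat φ` is a
closed condition for each parameter on the chord. -/
theorem isClosed_leafSet (hφ : LowerSemicontinuous φ) :
    IsClosed {p : {q : Circle × Circle // q.1 ≠ q.2} | (p : Circle × Circle) ∈ leafSet φ} := by
  have hmid : Continuous fun p : {q : Circle × Circle // q.1 ≠ q.2} =>
      envelope φ ((1 / 2 : ℝ) • (p.1.1 : ℂ) + (1 / 2 : ℝ) • (p.1.2 : ℂ)) :=
    (continuousOn_envelope hφ).comp_continuous (by fun_prop)
      fun p => geod_subset_Disc p.2 (midpoint_mem_geod p.1)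
  have h1 : LowerSemicontinuous fun p : {q : Circle × Circle // q.1 ≠ q.2} =>
      (φ p.1.1 + φ p.1.2) +
        -(2 * envelope φ ((1 / 2 : ℝ) • (p.1.1 : ℂ) + (1 / 2 : ℝ) • (p.1.2 : ℂ))) :=
    ((hφ.comp (by fun_prop)).add (hφ.comp (by fun_prop))).add
      (hmid.const_mul 2).neg.lowerSemicontinuous
  have h2 : IsClosed (⋂ t ∈ Ioo (0 : ℝ) 1, {p : {q : Circle × Circle // q.1 ≠ q.2} |
      (1 - t) • (p.1.1 : ℂ) + t • (p.1.2 : ℂ) ∈ (flat φ)ᶜ}) :=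
    isClosed_biInter fun t _ => (isOpen_flat φ).isClosed_compl.preimage (by fun_prop)
  convert (h1.isClosed_preimage 0).inter h2 using 1
  ext p
  simp only [leafSet, geod, openSegment_eq_image, mem_ofPred_eq, mem_inter_iff, mem_preimage,
    mem_Iic, mem_iInter, disjoint_left, forall_mem_image, mem_compl_iff, ← sub_eq_add_neg,
    sub_nonpos]
  exact ⟨fun h => h.2, fun h => ⟨p.2, h⟩⟩

/-- The lamination along which the graph of the envelope is bent. -/
def lamination (hφ : LowerSemicontinuous φ) : GeodesicLamination where
  leaves := leafSet φ
  ne_of_mem := fun _ hp => hp.1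
  symm := by
    rintro p ⟨h1, h2, h3⟩
    refine ⟨h1.symm, ?_, by rwa [geod_swap]⟩
    rw [Prod.fst_swap, Prod.snd_swap, add_comm (φ _), add_comm ((1 / 2 : ℝ) • _)]
    exact h2
  closed := isClosed_leafSet hφ
  disjoint := fun p hp q hq h1 h2 => disjoint_left.2 fun _ k1 k2 =>
    (eq_or_eq_swap_of_mem_geod hφ hp hq k1 k2).elim h1 h2

/-! ### Strata of the lamination -/

theorem Disc_diff_union_lamination (hφ : LowerSemicontinuous φ) :
    Disc \ (lamination hφ).union = flat φ := by
  ext η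
  constructor
  · rintro ⟨h1, h2⟩
    by_contra hn
    obtain ⟨p, hp, hη⟩ := exists_mem_leafSet_of_notMem_flat hφ h1 hn
    exact h2 (mem_iUnion₂.2 ⟨p, hp, hη⟩)
  · intro h
    refine ⟨flat_subset_Disc φ h, fun hu => ?_⟩
    obtain ⟨p, hp, hη⟩ := mem_iUnion₂.1 hu
    exact disjoint_left.1 hp.2.2 hη h

/-- Interiors of faces with different support planes are open and disjoint, and each one is convex.
-/
theorem connectedComponentIn_flat (hφ : LowerSemicontinuous φ) {σ : Mink} (hσ : σ ∈ minorants φ)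
    {η : ℂ} (hη : η ∈ interior (face φ σ)) :
    connectedComponentIn (flat φ) η = interior (face φ σ) := by
  have hsub : interior (face φ σ) ⊆ flat φ := fun y hy => mem_flat.2 ⟨σ, hσ, hy⟩
  apply Subset.antisymm
  · refine isPreconnected_connectedComponentIn.subset_left_of_subset_union isOpen_interior
      (v := ⋃ τ ∈ {τ | τ ∈ minorants φ ∧ τ ≠ σ}, interior (face φ τ))
      (isOpen_biUnion fun _ _ => isOpen_interior) ?_ ?_ ⟨η, mem_connectedComponentIn (hsub hη), hη⟩
    · refine disjoint_left.2 fun y h1 h2 => ?_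
      obtain ⟨τ, hτ, hy⟩ := mem_iUnion₂.1 h2
      exact hτ.2 (eq_of_mem_interior_face hτ.1 hσ hy (interior_subset h1))
    · intro y hy
      obtain ⟨τ, hτ, hyτ⟩ := mem_flat.1 (connectedComponentIn_subset _ _ hy)
      by_cases h : τ = σ
      · exact Or.inl (h ▸ hyτ)
      · exact Or.inr (mem_iUnion₂.2 ⟨τ, ⟨hτ, h⟩, hyτ⟩)
  · exact (convex_face hφ σ).interior.isPreconnected.subset_connectedComponentIn hη hsub

theorem isStratum_lamination_iff (hφ : LowerSemicontinuous φ) {S : Set ℂ} :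
    (lamination hφ).IsStratum S ↔ (∃ p ∈ leafSet φ, S = geod p) ∨
      ∃ σ ∈ minorants φ, (interior (face φ σ)).Nonempty ∧ S = interior (face φ σ) := by
  rw [GeodesicLamination.IsStratum, Disc_diff_union_lamination]
  refine or_congr Iff.rfl ⟨?_, ?_⟩
  · rintro ⟨x, hx, rfl⟩
    obtain ⟨σ, hσ, h⟩ := mem_flat.1 hx
    exact ⟨σ, hσ, ⟨x, h⟩, connectedComponentIn_flat hφ hσ h⟩
  · rintro ⟨σ, hσ, ⟨x, hx⟩, rfl⟩
    exact ⟨x, mem_flat.2 ⟨σ, hσ, hx⟩, (connectedComponentIn_flat hφ hσ hx).symm⟩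

theorem exists_isStratum_mem (hφ : LowerSemicontinuous φ) {η : ℂ} (hη : η ∈ Disc) :
    ∃ S, (lamination hφ).IsStratum S ∧ η ∈ S := by
  by_cases h : η ∈ flat φ
  · obtain ⟨σ, hσ, h⟩ := mem_flat.1 h
    exact ⟨_, (isStratum_lamination_iff hφ).2 (Or.inr ⟨σ, hσ, ⟨η, h⟩, rfl⟩), h⟩
  · obtain ⟨p, hp, h⟩ := exists_mem_leafSet_of_notMem_flat hφ hη h
    exact ⟨_, (isStratum_lamination_iff hφ).2 (Or.inl ⟨p, hp, rfl⟩), h⟩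

theorem eq_of_isStratum_of_mem (hφ : LowerSemicontinuous φ) {S S' : Set ℂ}
    (hS : (lamination hφ).IsStratum S) (hS' : (lamination hφ).IsStratum S') {η : ℂ}
    (h : η ∈ S) (h' : η ∈ S') : S = S' := by
  rcases (isStratum_lamination_iff hφ).1 hS with ⟨p, hp, rfl⟩ | ⟨σ, hσ, -, rfl⟩ <;>
    rcases (isStratum_lamination_iff hφ).1 hS' with ⟨q, hq, rfl⟩ | ⟨τ, hτ, -, rfl⟩
  · rcases eq_or_eq_swap_of_mem_geod hφ hp hq h h' with rfl | rfl
    · rfl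
    · exact (geod_swap p).symm
  · exact (disjoint_left.1 hp.2.2 h (mem_flat.2 ⟨τ, hτ, h'⟩)).elim
  · exact (disjoint_left.1 hq.2.2 h' (mem_flat.2 ⟨σ, hσ, h⟩)).elim
  · rw [eq_of_mem_interior_face hσ hτ h (interior_subset h')]

theorem nonempty_of_isStratum (hφ : LowerSemicontinuous φ) {S : Set ℂ}
    (hS : (lamination hφ).IsStratum S) : S.Nonempty := by
  rcases (isStratum_lamination_iff hφ).1 hS with ⟨p, -, rfl⟩ | ⟨σ, -, h, rfl⟩
  · exact ⟨_, midpoint_mem_geod p⟩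
  · exact h

theorem exists_subset_face_of_isStratum (hφ : LowerSemicontinuous φ) {S : Set ℂ}
    (hS : (lamination hφ).IsStratum S) : ∃ σ ∈ minorants φ, S ⊆ face φ σ := by
  rcases (isStratum_lamination_iff hφ).1 hS with ⟨p, hp, rfl⟩ | ⟨σ, hσ, -, rfl⟩
  · have hD := geod_subset_Disc hp.1 (midpoint_mem_geod p)
    obtain ⟨σ, hσ, h⟩ := exists_support hφ hD
    obtain ⟨h1, h2⟩ := contact_of_mem_leafSet hφ hσ hp (midpoint_mem_geod p) ⟨hD, h.ge⟩
    exact ⟨σ, hσ, geod_subset_face hφ hp.1 h1 h2⟩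
  · exact ⟨σ, hσ, interior_subset⟩

/-- If the face has interior, that gap serves as `R`, its closure containing the convex face.
Otherwise there is no third contact point, and the two strata are the same leaf. -/
theorem exists_isStratum_of_subset_face (hφ : LowerSemicontinuous φ) {S S' : Set ℂ}
    (hS : (lamination hφ).IsStratum S) (hS' : (lamination hφ).IsStratum S') {σ : Mink}
    (hσ : σ ∈ minorants φ) (h : S ⊆ face φ σ) (h' : S' ⊆ face φ σ) :
    ∃ R, (lamination hφ).IsStratum R ∧ S ⊆ closure R ∧ S' ⊆ closure R := by
  have hgap : (interior (face φ σ)).Nonempty →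
      ∃ R, (lamination hφ).IsStratum R ∧ S ⊆ closure R ∧ S' ⊆ closure R := by
    intro hne
    have hcl : face φ σ ⊆ closure (interior (face φ σ)) := by
      rw [(convex_face hφ σ).closure_interior_eq_closure_of_nonempty_interior hne]
      exact subset_closure
    exact ⟨_, (isStratum_lamination_iff hφ).2 (Or.inr ⟨σ, hσ, hne, rfl⟩), h.trans hcl,
      h'.trans hcl⟩
  rcases (isStratum_lamination_iff hφ).1 hS with ⟨p, hp, rfl⟩ | ⟨τ, hτ, ⟨x, hx⟩, rfl⟩
  · rcases (isStratum_lamination_iff hφ).1 hS' with ⟨q, hq, rfl⟩ | ⟨τ, hτ, ⟨x, hx⟩, rfl⟩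
    · have hmp := midpoint_mem_geod p
      have hmq := midpoint_mem_geod q
      obtain ⟨p1, p2⟩ := contact_of_mem_leafSet hφ hσ hp hmp (h hmp)
      obtain ⟨q1, q2⟩ := contact_of_mem_leafSet hφ hσ hq hmq (h' hmq)
      by_cases k1 : q.1 ≠ p.1 ∧ q.1 ≠ p.2
      · exact hgap ⟨_, add_half_mem_interior_face hφ hp.1 p1 p2 q1 k1.1 k1.2 hmp⟩
      by_cases k2 : q.2 ≠ p.1 ∧ q.2 ≠ p.2
      · exact hgap ⟨_, add_half_mem_interior_face hφ hp.1 p1 p2 q2 k2.1 k2.2 hmp⟩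
      have hpq : geod q = geod p := by
        have hne := hq.1
        rcases p with ⟨a, b⟩
        rcases q with ⟨c, d⟩
        have hcd : c = a ∧ d = b ∨ c = b ∧ d = a := by
          simp only [not_and_or, not_not] at k1 k2
          grind
        rcases hcd with ⟨rfl, rfl⟩ | ⟨rfl, rfl⟩
        · rfl
        · exact geod_swap (d, c)
      exact ⟨_, hS, subset_closure, hpq ▸ subset_closure⟩
    · obtain rfl := eq_of_mem_interior_face hτ hσ hx (h' hx)
      exact hgap ⟨x, hx⟩
  · obtain rfl := eq_of_mem_interior_face hτ hσ hx (h hx)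
    exact hgap ⟨x, hx⟩

/-! ### From support planes to earthquakes -/

/-- The lamination of `φ` with a choice of a support plane of the envelope for each stratum, and the
vector `s S` of the support plane of `S`. The field obtained on the disc extends radially. -/
theorem exists_support_of_strata (hφ : LowerSemicontinuous φ) :
    ∃ (s : Set ℂ → Mink) (E : ℂ → ℂ),
      (∀ S, (lamination hφ).IsStratum S → s S ∈ minorants φ ∧ S ⊆ face φ (s S)) ∧
      (∀ S, (lamination hφ).IsStratum S → ∀ η ∈ S, E η = killing (Lam (s S)) η) ∧
      ∀ z : Circle, ∀ x ∈ Disc, Tendsto (fun t : ℝ => E ((1 - t) • (z : ℂ) + t • x)) (𝓝[>] 0)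
        (𝓝 ((φ z : ℂ) * (Complex.I * z))) := by
  have hs : ∀ S, ∃ σ, (lamination hφ).IsStratum S → σ ∈ minorants φ ∧ S ⊆ face φ σ := fun S => by
    by_cases h : (lamination hφ).IsStratum S
    · obtain ⟨σ, hσ⟩ := exists_subset_face_of_isStratum hφ h
      exact ⟨σ, fun _ => hσ⟩
    · exact ⟨0, fun h' => absurd h' h⟩
  choose s hs using hs
  have hc : ∀ η, ∃ S, η ∈ Disc → (lamination hφ).IsStratum S ∧ η ∈ S := fun η => by
    by_cases h : η ∈ Disc
    · obtain ⟨S, hS⟩ := exists_isStratum_mem hφ h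
      exact ⟨S, fun _ => hS⟩
    · exact ⟨∅, fun h' => absurd h' h⟩
  choose c hc using hc
  refine ⟨s, fun η => killing (Lam (s (c η))) η, hs, fun S hS η hη => ?_, fun z x hx => ?_⟩
  · have hD : η ∈ Disc := face_subset_Disc φ _ ((hs S hS).2 hη)
    dsimp only
    rw [eq_of_isStratum_of_mem hφ (hc η hD).1 hS (hc η hD).2 hη]
  · refine tendsto_killing_radial hφ z hx (σ := fun η => s (c η)) (fun η hη => ?_)
      fun η hη => ?_
    · exact (hs _ (hc η hη).1).1
    · exact envelope_eq_of_mem_face (hs _ (hc η hη).1).1 ((hs _ (hc η hη).1).2 (hc η hη).2)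

/-- The affine function of the comparison of two strata is nonpositive on the first one and nonnegative
on the second one, and the comparison is hyperbolic when it does not vanish. -/
theorem aff_sub_of_strata (hφ : LowerSemicontinuous φ) {S S' : Set ℂ}
    (hS : (lamination hφ).IsStratum S) (hS' : (lamination hφ).IsStratum S') {σ σ' : Mink}
    (hσ : σ ∈ minorants φ) (hσ' : σ' ∈ minorants φ) (h : S ⊆ face φ σ) (h' : S' ⊆ face φ σ')
    (hne : σ ≠ σ') :
    (∀ p ∈ S, aff (σ' - σ) p ≤ 0) ∧ (∀ q ∈ S', 0 ≤ aff (σ' - σ) q) ∧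
      0 < form (σ' - σ) (σ' - σ) := by
  have h1 : ∀ p ∈ S, aff (σ' - σ) p ≤ 0 := fun p hp => by
    rw [aff_sub, envelope_eq_of_mem_face hσ (h hp), sub_nonpos]
    exact aff_le_envelope hσ' (mem_Disc.1 (h hp).1).le
  have h2 : ∀ q ∈ S', 0 ≤ aff (σ' - σ) q := fun q hq => by
    rw [aff_sub, envelope_eq_of_mem_face hσ' (h' hq), sub_nonneg]
    exact aff_le_envelope hσ (mem_Disc.1 (h' hq).1).le
  obtain ⟨p, hp⟩ := nonempty_of_isStratum hφ hS
  obtain ⟨q, hq⟩ := nonempty_of_isStratum hφ hS'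
  -- The sign change produces a zero inside the disc, which forces `σ' - σ` to be spacelike.
  obtain ⟨x, hx, hx0⟩ := exists_aff_eq_zero (h hp).1 (h' hq).1 (h1 p hp) (h2 q hq)
  exact ⟨h1, h2, form_self_pos (sub_ne_zero.2 hne.symm) hx hx0⟩

theorem disjoint_of_strata (hφ : LowerSemicontinuous φ) {S S' : Set ℂ}
    (hS : (lamination hφ).IsStratum S) (hS' : (lamination hφ).IsStratum S') (hne : S ≠ S') :
    Disjoint S S' :=
  disjoint_left.2 fun _ h h' => hne (eq_of_isStratum_of_mem hφ hS hS' h h')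

theorem exists_isLeftInfEarthquake {X : Circle → ℂ} (hX : IsVectorField X)
    (hφ : LowerSemicontinuous (supportFunction X)) :
    ∃ E : ℂ → ℂ, IsLeftInfEarthquake E ∧ ExtendsRadially E X := by
  obtain ⟨s, E, hs, hE, hr⟩ := exists_support_of_strata hφ
  refine ⟨E, ⟨lamination hφ, fun S => Lam (s S), hE, fun S S' hS hS' => ⟨fun h => ?_, fun h => ?_⟩⟩,
    fun z x hx => ?_⟩
  · have he : s S' = s S := Lam_injective (sub_eq_zero.1 h)
    exact exists_isStratum_of_subset_face hφ hS hS' (hs S hS).1 (hs S hS).2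
      (he ▸ (hs S' hS').2)
  · have hne : s S ≠ s S' := fun he => h (by
      beta_reduce
      rw [he]
      exact sub_self (Lam (s S')))
    obtain ⟨h1, h2, hpos⟩ := aff_sub_of_strata hφ hS hS' (hs S hS).1 (hs S' hS').1 (hs S hS).2
      (hs S' hS').2 hne
    have hL := Lam_sub (s S') (s S)
    refine ⟨s S' - s S, hpos, hL, Or.inl ⟨h1, h2⟩, ?_⟩
    rw [hL]
    exact translatesLeft_Lam hpos ((hs S hS).2.trans (face_subset_Disc _ _))
      ((hs S' hS').2.trans (face_subset_Disc _ _))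
      (disjoint_of_strata hφ hS hS' fun he => hne (congrArg s he)) h1 h2
  · rw [eq_supportFunction_mul hX z]
    exact hr z x hx

/-- The construction for `-φ` is negated: the lamination is kept, while all comparison fields change
sign and so translate the other way. -/
theorem exists_isRightInfEarthquake {X : Circle → ℂ} (hX : IsVectorField X)
    (hφ : UpperSemicontinuous (supportFunction X)) :
    ∃ E : ℂ → ℂ, IsRightInfEarthquake E ∧ ExtendsRadially E X := by
  have hφ' : LowerSemicontinuous fun z => -supportFunction X z :=
    continuous_neg.comp_upperSemicontinuous_antitone hφ fun _ _ h => neg_le_neg h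
  obtain ⟨s, E, hs, hE, hr⟩ := exists_support_of_strata hφ'
  refine ⟨fun η => -E η, ⟨lamination hφ', fun S => Lam (-s S), fun S hS η hη => ?_,
    fun S S' hS hS' => ⟨fun h => ?_, fun h => ?_⟩⟩, fun z x hx => ?_⟩
  · beta_reduce
    rw [hE S hS η hη, Lam_neg, killing_neg]
  · have he : s S' = s S := neg_injective (Lam_injective (sub_eq_zero.1 h))
    exact exists_isStratum_of_subset_face hφ' hS hS' (hs S hS).1 (hs S hS).2
      (he ▸ (hs S' hS').2)
  · have hne : s S ≠ s S' := fun he => h (by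
      beta_reduce
      rw [he]
      exact sub_self (Lam (-s S')))
    obtain ⟨h1, h2, hpos⟩ := aff_sub_of_strata hφ' hS hS' (hs S hS).1 (hs S' hS').1 (hs S hS).2
      (hs S' hS').2 hne
    have hL : Lam (-s S') - Lam (-s S) = Lam (-(s S' - s S)) := by
      rw [Lam_sub]
      congr 1
      abel
    have h1' : ∀ p ∈ S, 0 ≤ aff (-(s S' - s S)) p := fun p hp => by
      rw [aff_neg]; linarith [h1 p hp]
    have h2' : ∀ q ∈ S', aff (-(s S' - s S)) q ≤ 0 := fun q hq => by
      rw [aff_neg]; linarith [h2 q hq]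
    have hpos' : 0 < form (-(s S' - s S)) (-(s S' - s S)) := by
      simpa only [form, Pi.neg_apply, neg_mul_neg] using hpos
    refine ⟨-(s S' - s S), hpos', hL, Or.inr ⟨h1', h2'⟩, ?_⟩
    rw [hL]
    exact translatesRight_Lam hpos' ((hs S hS).2.trans (face_subset_Disc _ _))
      ((hs S' hS').2.trans (face_subset_Disc _ _))
      (disjoint_of_strata hφ' hS hS' fun he => hne (congrArg s he)) h1' h2'
  · rw [eq_supportFunction_mul hX z]
    simpa using (hr z x hx).neg

end

end InfEarthquake

theorem theorem1p2 (X : Circle → ℂ) (hX : InfEarthquake.IsVectorField X) :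
    (LowerSemicontinuous (InfEarthquake.supportFunction X) →
      ∃ E : ℂ → ℂ, InfEarthquake.IsLeftInfEarthquake E ∧ InfEarthquake.ExtendsRadially E X) ∧
    (UpperSemicontinuous (InfEarthquake.supportFunction X) →
      ∃ E : ℂ → ℂ, InfEarthquake.IsRightInfEarthquake E ∧ InfEarthquake.ExtendsRadially E X) :=
  ⟨InfEarthquake.exists_isLeftInfEarthquake hX, InfEarthquake.exists_isRightInfEarthquake hX⟩
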